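/- For a tensor $\mathbf T\in(\mathbb R^n)^{\otimes 3}$ put $\mathbf T(x)=\sum_{ijk}\mathbf T_{ijk}x_ix_jx_k$. A degree-$4$ pseudo-distribution on the sphere is a linear functional $\tilde{\mathbb E}$ on the real polynomials in $x=(x_1,\dots,x_n)$ of degree at most $4$ with $\tilde{\mathbb E}\,1=1$, $\tilde{\mathbb E}\,p^2\ge 0$ whenever $\deg p\le 2$, and $\tilde{\mathbb E}\,(\|x\|^2-1)q=0$ whenever $\deg\big((\|x\|^2-1)q\big)\le 4$. Write $\rho_n=n^{3/4}(\log n)^{1/4}$. Consider two algorithms. Recovery: on input $\mathbf T$, take a degree-$4$ pseudo-distribution on the sphere that maximizes $\tilde{\mathbb E}\,\mathbf T(x)$ and output $v=\tilde{\mathbb E}x/\|\tilde{\mathbb E}x\|$ (with $v=0$ if $\tilde{\mathbb E}x=0$). Certification with threshold constant $\Theta$: on input $\mathbf T,\tau$, run Recovery to obtain $v$, maximize $\tilde{\mathbb E}\,[\mathbf T(x)-\tau\langle v,x\rangle^3]$ over all degree-$4$ pseudo-distributions on the sphere, and output CERTIFY if the maximum is at most $\Theta\rho_n$; otherwise output FAIL.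 Then the following hold. (0) For every $n\ge1$ and every polynomial $p$ of degree at most $4$, $\tilde{\mathbb E}\,p$ attains its maximum over the degree-$4$ pseudo-distributions on the sphere; in particular both algorithms are well defined (up to the choice of maximizers). (1) For every $\Theta,\tau\in\mathbb R$, every unit vector $v_0\in\mathbb R^n$ and every tensor $\mathbf A$: if, on input $\mathbf T=\tau v_0^{\otimes3}+\mathbf A$ and $\tau$, Certification with threshold constant $\Theta$ outputs CERTIFY, then $\mathbf T(x)\le\tau\langle v,x\rangle^3+\Theta\rho_n$ for all unit vectors $x\in\mathbb R^n$. (2) There are absolute constants $\Theta,K>0$, and for each $c>0$ a constant $C>0$ depending only on $c$, such that the following holds for all $n\ge 1$, all unit vectors $v_0\in\mathbb R^n$, all $\varepsilon>0$ and all $\tau\ge c\,\rho_n/\varepsilon$. Let $\mathbf A$ be a random tensor with independent $\mathcal N(0,1)$ entries. With probability at least $1-Kn^{-10}$, on input $\tau v_0^{\otimes3}+\mathbf A$ and also on input $\tau v_0^{\otimes 3}+\frac1{6}\sum_{\pi\in S_3}\mathbf A^\pi$ (where $\mathbf A^\pi$ is $\mathbf A$ with indices permuted by $\pi$), every possible output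 $v$ of Recovery satisfies $\langle v,v_0\rangle\ge 1-C\varepsilon$, and Certification with threshold constant $\Theta$ outputs CERTIFY, whichever maximizers are chosen. With probability at least $1-Kn^{-10}$ the same holds on input $\tau v_0^{\otimes3}+\mathbf A$ when instead $\mathbf A$ is a random symmetric tensor with standard Gaussian entries that are independent over the multi-indices $i\le j\le k$. -/

import Mathlib

namespace TensorPCA

open MeasureTheory ProbabilityTheory

/-- Real tensors of order `3` on `ℝⁿ`, indexed by multi-indices `α = (i, j, k)`. -/
abbrev Tensor (n : ℕ) : Type := (Fin 3 → Fin n) → ℝ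

/-- The rank-one tensor `v^{⊗3}`. -/
def tensorCube {n : ℕ} (v : EuclideanSpace ℝ (Fin n)) : Tensor n :=
  fun α => ∏ r, v (α r)

/-- `T(x) = ⟨x^{⊗3}, T⟩ = ∑ T_{ijk} x_i x_j x_k` at a point `x ∈ ℝⁿ`. -/
def tensorEval {n : ℕ} (T : Tensor n) (x : EuclideanSpace ℝ (Fin n)) : ℝ :=
  ∑ α, T α * ∏ r, x (α r)

/-- The spiked tensor `τ · v₀^{⊗3} + A`. -/
def spiked {n : ℕ} (τ : ℝ) (v₀ : EuclideanSpace ℝ (Fin n)) (A : Tensor n) : Tensor n :=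
  fun α => τ * tensorCube v₀ α + A α

/-- The tensor `A^π` whose indices are permuted according to `π`. -/
def permTensor {n : ℕ} (π : Equiv.Perm (Fin 3)) (A : Tensor n) : Tensor n :=
  fun α => A (fun r => α (π⁻¹ r))

/-- The symmetrization `(1 / |S₃|) ∑_{π ∈ S₃} A^π`. -/
noncomputable def symmetrize {n : ℕ} (A : Tensor n) : Tensor n :=
  fun α => (1 / (Fintype.card (Equiv.Perm (Fin 3)) : ℝ)) *
    ∑ π : Equiv.Perm (Fin 3), permTensor π A α

/-- A random tensor with independent standard Gaussian entries. -/
structure IsGaussianNoise {Ω : Type*} [MeasurableSpace Ω] {n : ℕ}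
    (A : Ω → Tensor n) (P : Measure Ω) : Prop where
  hasLaw : ∀ α, HasLaw (fun ω => A ω α) (gaussianReal 0 1) P
  indep : iIndepFun (fun (α : Fin 3 → Fin n) ω => A ω α) P

/-- A random symmetric tensor, with otherwise iid standard Gaussian entries: the entries at the
nondecreasing multi-indices (one from each orbit of `S₃`) are independent. -/
structure IsSymmetricGaussianNoise {Ω : Type*} [MeasurableSpace Ω] {n : ℕ}
    (A : Ω → Tensor n) (P : Measure Ω) : Prop where
  symm : ∀ ω (π : Equiv.Perm (Fin 3)), permTensor π (A ω) = A ω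
  hasLaw : ∀ α, HasLaw (fun ω => A ω α) (gaussianReal 0 1) P
  indep : iIndepFun (fun (α : {α : Fin 3 → Fin n // Monotone α}) ω => A ω α.1) P

/-- `ℝ[x]_{≤ d}`: real polynomials in `x₁, …, xₙ` of total degree at most `d`. -/
noncomputable abbrev PolyLE (n d : ℕ) : Submodule ℝ (MvPolynomial (Fin n) ℝ) :=
  MvPolynomial.restrictTotalDegree (Fin n) ℝ d

theorem one_mem_polyLE (n d : ℕ) : (1 : MvPolynomial (Fin n) ℝ) ∈ PolyLE n d := by
  rw [MvPolynomial.mem_restrictTotalDegree]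
  simp

theorem sq_mem_polyLE {n d : ℕ} {p : MvPolynomial (Fin n) ℝ} (hp : p.totalDegree ≤ d / 2) :
    p ^ 2 ∈ PolyLE n d := by
  rw [MvPolynomial.mem_restrictTotalDegree]
  have := MvPolynomial.totalDegree_pow p 2
  omega

theorem X_mem_polyLE {n : ℕ} (i : Fin n) :
    (MvPolynomial.X i : MvPolynomial (Fin n) ℝ) ∈ PolyLE n 4 := by
  rw [MvPolynomial.mem_restrictTotalDegree, MvPolynomial.totalDegree_X]
  norm_num

/-- A degree-`d` pseudo-expectation (for even `d`): a linear functional on `ℝ[x]_{≤ d}` with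
`L 1 = 1` and `L p² ≥ 0` for all `p ∈ ℝ[x]_{≤ d/2}`. -/
structure IsPseudoExpectation {n d : ℕ} (L : PolyLE n d →ₗ[ℝ] ℝ) : Prop where
  map_one : L ⟨1, one_mem_polyLE n d⟩ = 1
  sq_nonneg : ∀ (p : MvPolynomial (Fin n) ℝ) (hp : p.totalDegree ≤ d / 2),
    0 ≤ L ⟨p ^ 2, sq_mem_polyLE hp⟩

/-- `L` satisfies `{p(x) = 0}`: `L (p q) = 0` for all `q` with `p q ∈ ℝ[x]_{≤ d}`. -/
def Satisfies {n d : ℕ} (L : PolyLE n d →ₗ[ℝ] ℝ) (p : MvPolynomial (Fin n) ℝ) : Prop :=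
  ∀ (q : MvPolynomial (Fin n) ℝ) (h : p * q ∈ PolyLE n d), L ⟨p * q, h⟩ = 0

/-- The polynomial `‖x‖² - 1`. -/
noncomputable def spherePoly (n : ℕ) : MvPolynomial (Fin n) ℝ :=
  ∑ i, MvPolynomial.X i ^ 2 - 1

/-- `L` is a degree-`4` pseudo-expectation satisfying `{‖x‖² = 1}`. -/
def IsSpherePseudoExpectation {n : ℕ} (L : PolyLE n 4 →ₗ[ℝ] ℝ) : Prop :=
  IsPseudoExpectation L ∧ Satisfies L (spherePoly n)

/-- `L` is an optimal solution of the degree-`4` sum-of-squares relaxation of maximizing `p` over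
the unit sphere. -/
def IsOptimal {n : ℕ} (L : PolyLE n 4 →ₗ[ℝ] ℝ) (p : PolyLE n 4) : Prop :=
  IsSpherePseudoExpectation L ∧ ∀ L', IsSpherePseudoExpectation L' → L' p ≤ L p

/-- The polynomial `T(x) = ∑ T_{ijk} x_i x_j x_k`. -/
noncomputable def tensorPoly {n : ℕ} (T : Tensor n) : MvPolynomial (Fin n) ℝ :=
  ∑ α, MvPolynomial.C (T α) * ∏ r, MvPolynomial.X (α r)

/-- The linear form `⟨v, x⟩`. -/
noncomputable def linearPoly {n : ℕ} (v : EuclideanSpace ℝ (Fin n)) : MvPolynomial (Fin n) ℝ :=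
  ∑ i, MvPolynomial.C (v i) * MvPolynomial.X i

theorem tensorPoly_mem {n : ℕ} (T : Tensor n) : tensorPoly T ∈ PolyLE n 4 := by
  refine Submodule.sum_mem _ fun α _ => ?_
  rw [MvPolynomial.mem_restrictTotalDegree]
  refine (MvPolynomial.totalDegree_mul _ _).trans ?_
  have h := MvPolynomial.totalDegree_finsetProd (Finset.univ : Finset (Fin 3))
    (fun r => (MvPolynomial.X (α r) : MvPolynomial (Fin n) ℝ))
  simp only [MvPolynomial.totalDegree_X, Finset.sum_const, Finset.card_univ, Fintype.card_fin,
    smul_eq_mul] at h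
  rw [MvPolynomial.totalDegree_C]
  omega

theorem linearPoly_totalDegree {n : ℕ} (v : EuclideanSpace ℝ (Fin n)) :
    (linearPoly v).totalDegree ≤ 1 := by
  refine (MvPolynomial.totalDegree_finsetSum _ _).trans (Finset.sup_le fun i _ => ?_)
  refine (MvPolynomial.totalDegree_mul _ _).trans ?_
  rw [MvPolynomial.totalDegree_C, MvPolynomial.totalDegree_X]

theorem residual_mem {n : ℕ} (τ : ℝ) (T : Tensor n) (v : EuclideanSpace ℝ (Fin n)) :
    tensorPoly T - MvPolynomial.C τ * linearPoly v ^ 3 ∈ PolyLE n 4 := by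
  refine Submodule.sub_mem _ (tensorPoly_mem T) ?_
  rw [MvPolynomial.mem_restrictTotalDegree]
  refine (MvPolynomial.totalDegree_mul _ _).trans ?_
  have h := MvPolynomial.totalDegree_pow (linearPoly v) 3
  have h' := linearPoly_totalDegree v
  rw [MvPolynomial.totalDegree_C]
  omega

/-- The objective `T(x)` of the recovery relaxation. -/
noncomputable def recoveryObjective {n : ℕ} (T : Tensor n) : PolyLE n 4 :=
  ⟨tensorPoly T, tensorPoly_mem T⟩

/-- The objective `T(x) - τ ⟨v, x⟩³` of the certification relaxation. -/
noncomputable def certificationObjective {n : ℕ} (τ : ℝ) (T : Tensor n)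
    (v : EuclideanSpace ℝ (Fin n)) : PolyLE n 4 :=
  ⟨tensorPoly T - MvPolynomial.C τ * linearPoly v ^ 3, residual_mem τ T v⟩

/-- The vector `Ẽ x` of degree-`1` pseudo-moments. -/
noncomputable def pseudoMean {n : ℕ} (L : PolyLE n 4 →ₗ[ℝ] ℝ) : EuclideanSpace ℝ (Fin n) :=
  WithLp.toLp 2 fun i => L ⟨MvPolynomial.X i, X_mem_polyLE i⟩

/-- `v` is a possible output of the recovery algorithm on input `T`: it is `Ẽ x / ‖Ẽ x‖` for an
optimal degree-`4` pseudo-distribution on the sphere (and `0` if `Ẽ x = 0`). -/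
def IsRecoveryOutput {n : ℕ} (T : Tensor n) (v : EuclideanSpace ℝ (Fin n)) : Prop :=
  ∃ L : PolyLE n 4 →ₗ[ℝ] ℝ,
    IsOptimal L (recoveryObjective T) ∧ v = ‖pseudoMean L‖⁻¹ • pseudoMean L

/-- The rate `n^{3/4} (log n)^{1/4}`. -/
noncomputable def rate (n : ℕ) : ℝ :=
  (n : ℝ) ^ (3 / 4 : ℝ) * Real.log n ^ (1 / 4 : ℝ)

/-- The certification algorithm, run with the threshold `Θ n^{3/4} (log n)^{1/4}` and the vector `v`
produced by the recovery algorithm, outputs CERTIFY: the optimal value of the relaxation with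
objective `T(x) - τ ⟨v, x⟩³` is at most the threshold. -/
def Certifies {n : ℕ} (Θ τ : ℝ) (T : Tensor n) (v : EuclideanSpace ℝ (Fin n)) : Prop :=
  ∃ L : PolyLE n 4 →ₗ[ℝ] ℝ, IsOptimal L (certificationObjective τ T v) ∧
    L (certificationObjective τ T v) ≤ Θ * rate n

/-- On input `T`, every possible output `v` of the recovery algorithm has `⟨v, v₀⟩ ≥ 1 - δ`. -/
def Recovers {n : ℕ} (δ : ℝ) (v₀ : EuclideanSpace ℝ (Fin n)) (T : Tensor n) : Prop :=
  ∀ v, IsRecoveryOutput T v → 1 - δ ≤ inner ℝ v v₀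

/-- On input `T`, the certification algorithm outputs CERTIFY, whichever output `v` of the recovery
algorithm it starts from. -/
def AlwaysCertifies {n : ℕ} (Θ τ : ℝ) (T : Tensor n) : Prop :=
  ∀ v, IsRecoveryOutput T v → Certifies Θ τ T v

end TensorPCA

/-!
Both relaxations are analysed through one property of the noise `A`, called `CubicBound A R`: the cubic
form of `A` equals `∑ᵢ xᵢ ⟨x, aᵢ x⟩` for a symmetric tensor with slices `aᵢ`, and every degree-`4`
pseudo-expectation on the sphere satisfies `∑ᵢ ⟨y, aᵢ y⟩² ≤ R² ‖y‖⁴` for affine `y`.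

*Algorithms.* Let `Ẽ` be optimal for the recovery relaxation, `t = ⟨v₀, x⟩`, `z = x - v₀`, and
`η = Ẽ (1 - t)`, so that `Ẽ ‖z‖² = 2 η`. The increment `A(x) - A(v₀)` is a combination of terms
`∑ᵢ zᵢ ⟨y, aᵢ y⟩` with `y ∈ {v₀, x, z}` (`triForm_increment`), so by Cauchy–Schwarz it is at most of
order `R √η` (`SpherePE.triForm_sub_le`), while the spike loses `τ Ẽ (1 - t³) ≥ (3/4) τ η`. Comparing
with the point `v₀` gives `η = O((R / τ)²)` (`CubicBound.one_sub_inner_le`). This rate is quadratic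
in `R / τ`; therefore `‖v - v₀‖ = O(R / τ)`, and the residual spike
`τ (⟨v₀, x⟩³ - ⟨v, x⟩³)` is `O(R)`, uniformly in `τ` (`CubicBound.certifies`).

*Noise.* For independent sub-Gaussian entries, `R = O(n^{3/4})` outside an event of exponentially
small probability. The sum `∑ᵢ ⟨y, aᵢ y⟩²` splits into the part with equal first slice indices
`j = l` and the part with `j ≠ l`. Both are quadratic forms in the products `yⱼ yₖ`, and bounds for
quadratic forms over the reals pass to pseudo-expectations (`SpherePE.gram_le`). The first part is
controlled by the injective norm of the tensor, which is `O(√n)` by a net argument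
(`measure_not_injBound_le`). The second part is four times the average over `S ⊆ [n]` of its
restriction to `j ∈ S`, `l ∉ S` (`two_pow_mul_sum_sq`). Conditionally on the rows outside `S`, this
restriction is linear in the other rows, with variance again bounded by the injective norm
(`measure_decoupled_le`), so that a union bound over a net in dimension `n²` and over all `S` gives
operator norm `O(n^{3/2})`. No logarithmic factor is needed.

A tensor and its symmetrization have the same cubic form, and a symmetric tensor has the same cubic
form as a tensor supported on nondecreasing multi-indices, whose entries are independent
(`tensorPoly_eq_of_symm`); so all three noise models reduce to independent entries.
-/

namespace TensorPCA

open MeasureTheory ProbabilityTheory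
open scoped NNReal ENNReal

/-! ### Pseudo-expectations on all polynomials -/

/-- A linear functional on all polynomials whose restriction to degree at most `4` is a
pseudo-expectation on the sphere. Values on polynomials of higher degree are arbitrary; extending
the functional avoids carrying degree bounds through linear manipulations. -/
structure SpherePE {n : ℕ} (E : MvPolynomial (Fin n) ℝ →ₗ[ℝ] ℝ) : Prop where
  map_one : E 1 = 1
  sq_nonneg : ∀ p : MvPolynomial (Fin n) ℝ, p.totalDegree ≤ 2 → 0 ≤ E (p ^ 2)
  sphere : ∀ q : MvPolynomial (Fin n) ℝ, q.totalDegree ≤ 2 → E (spherePoly n * q) = 0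

section degree

variable {n : ℕ} {p q : MvPolynomial (Fin n) ℝ} {a b : ℕ}

theorem totalDegree_mul_le (hp : p.totalDegree ≤ a) (hq : q.totalDegree ≤ b) :
    (p * q).totalDegree ≤ a + b :=
  (MvPolynomial.totalDegree_mul _ _).trans (add_le_add hp hq)

theorem totalDegree_add_le (hp : p.totalDegree ≤ a) (hq : q.totalDegree ≤ a) :
    (p + q).totalDegree ≤ a :=
  (MvPolynomial.totalDegree_add _ _).trans (max_le hp hq)

theorem totalDegree_sub_le (hp : p.totalDegree ≤ a) (hq : q.totalDegree ≤ a) :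
    (p - q).totalDegree ≤ a :=
  (MvPolynomial.totalDegree_sub _ _).trans (max_le hp hq)

theorem totalDegree_C_mul_le (r : ℝ) (hp : p.totalDegree ≤ a) :
    (MvPolynomial.C r * p).totalDegree ≤ a := by
  have h : (MvPolynomial.C r : MvPolynomial (Fin n) ℝ).totalDegree ≤ 0 := by simp
  simpa using totalDegree_mul_le h hp

theorem totalDegree_sum_le {κ : Type*} (s : Finset κ) (f : κ → MvPolynomial (Fin n) ℝ)
    (h : ∀ i ∈ s, (f i).totalDegree ≤ a) : (∑ i ∈ s, f i).totalDegree ≤ a :=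
  (MvPolynomial.totalDegree_finsetSum _ _).trans (Finset.sup_le h)

theorem spherePoly_totalDegree : (spherePoly n).totalDegree ≤ 2 := by
  refine totalDegree_sub_le (totalDegree_sum_le _ _ fun i _ => ?_) (by simp)
  rw [MvPolynomial.totalDegree_X_pow]

end degree

namespace SpherePE

variable {n : ℕ} {E : MvPolynomial (Fin n) ℝ →ₗ[ℝ] ℝ}

theorem C_mul (E : MvPolynomial (Fin n) ℝ →ₗ[ℝ] ℝ) (a : ℝ) (p : MvPolynomial (Fin n) ℝ) :
    E (MvPolynomial.C a * p) = a * E p := by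
  rw [MvPolynomial.C_mul', map_smul, smul_eq_mul]

theorem map_C (hE : SpherePE E) (a : ℝ) : E (MvPolynomial.C a) = a := by
  have := C_mul E a 1
  rwa [mul_one, hE.map_one, mul_one] at this

theorem sum_sq_nonneg (hE : SpherePE E) {κ : Type*} [Fintype κ]
    {p : κ → MvPolynomial (Fin n) ℝ} (hp : ∀ i, (p i).totalDegree ≤ 2) :
    0 ≤ E (∑ i, p i ^ 2) := by
  rw [map_sum]
  exact Finset.sum_nonneg fun i _ => hE.sq_nonneg _ (hp i)

/-- The Cauchy–Schwarz inequality for pseudo-expectations. -/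
theorem cauchySchwarz (hE : SpherePE E) {κ : Type*} [Fintype κ]
    {p q : κ → MvPolynomial (Fin n) ℝ} (hp : ∀ i, (p i).totalDegree ≤ 2)
    (hq : ∀ i, (q i).totalDegree ≤ 2) :
    E (∑ i, p i * q i) ^ 2 ≤ E (∑ i, p i ^ 2) * E (∑ i, q i ^ 2) := by
  have key : ∀ t : ℝ, 0 ≤ E (∑ i, p i ^ 2) * (t * t) + (2 * E (∑ i, p i * q i)) * t
      + E (∑ i, q i ^ 2) := by
    intro t
    have h := hE.sum_sq_nonneg (p := fun i => MvPolynomial.C t * p i + q i)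
      fun i => totalDegree_add_le (totalDegree_C_mul_le t (hp i)) (hq i)
    have e : (∑ i, (MvPolynomial.C t * p i + q i) ^ 2) =
        MvPolynomial.C (t * t) * ∑ i, p i ^ 2 + MvPolynomial.C (2 * t) * ∑ i, p i * q i
          + ∑ i, q i ^ 2 := by
      simp only [Finset.mul_sum, ← Finset.sum_add_distrib, map_mul, map_ofNat]
      exact Finset.sum_congr rfl fun i _ => by ring
    rw [e, map_add, map_add, C_mul, C_mul] at h
    linarith
  have := discrim_le_zero key
  rw [discrim] at this
  linarith

theorem cauchySchwarz_sqrt (hE : SpherePE E) {κ : Type*} [Fintype κ]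
    {p q : κ → MvPolynomial (Fin n) ℝ} (hp : ∀ i, (p i).totalDegree ≤ 2)
    (hq : ∀ i, (q i).totalDegree ≤ 2) :
    |E (∑ i, p i * q i)| ≤ √(E (∑ i, p i ^ 2)) * √(E (∑ i, q i ^ 2)) := by
  rw [← Real.sqrt_mul (hE.sum_sq_nonneg hp)]
  exact Real.abs_le_sqrt (hE.cauchySchwarz hp hq)

/-- A bound on a quadratic form over the reals transfers to pseudo-expectations, because the Gram
matrix `E (s p * s q)` is positive semidefinite. -/
theorem gram_le (hE : SpherePE E) {κ : Type*} [Fintype κ]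
    {Z : κ → κ → ℝ} {K : ℝ} (hZ : ∀ x : κ → ℝ, ∑ p, ∑ q, Z p q * (x p * x q) ≤ K * ∑ p, x p ^ 2)
    {s : κ → MvPolynomial (Fin n) ℝ} (hs : ∀ p, (s p).totalDegree ≤ 2) :
    E (∑ p, ∑ q, MvPolynomial.C (Z p q) * (s p * s q)) ≤ K * E (∑ p, s p ^ 2) := by
  classical
  let G : Matrix κ κ ℝ := Matrix.of fun p q => E (s p * s q)
  have hG : G.PosSemidef := by
    refine Matrix.PosSemidef.of_dotProduct_mulVec_nonneg ?_ fun x => ?_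
    · ext p q
      simp [G, mul_comm]
    · have h := hE.sq_nonneg (∑ p, MvPolynomial.C (x p) * s p)
        (totalDegree_sum_le _ _ fun p _ => totalDegree_C_mul_le _ (hs p))
      rw [sq, Finset.sum_mul_sum, map_sum] at h
      simp only [map_sum] at h
      have e : star x ⬝ᵥ G.mulVec x =
          ∑ p, ∑ q, E (MvPolynomial.C (x p) * s p * (MvPolynomial.C (x q) * s q)) := by
        simp only [dotProduct, Matrix.mulVec, G, Matrix.of_apply, star_trivial, Finset.mul_sum]
        refine Finset.sum_congr rfl fun p _ => Finset.sum_congr rfl fun q _ => ?_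
        rw [mul_assoc, C_mul, mul_left_comm (s p), C_mul]
        ring
      rw [e]
      exact h
  obtain ⟨m, v, hv⟩ := Matrix.posSemidef_iff_eq_sum_vecMulVec.mp hG
  have hGB : ∀ p q, E (s p * s q) = ∑ r, v r p * v r q := by
    intro p q
    have := congrFun (congrFun hv p) q
    simpa [G, Matrix.sum_apply, Matrix.vecMulVec_apply] using this
  have h1 : E (∑ p, ∑ q, MvPolynomial.C (Z p q) * (s p * s q)) =
      ∑ r, ∑ p, ∑ q, Z p q * (v r p * v r q) := by
    simp only [map_sum, C_mul, hGB, Finset.mul_sum]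
    rw [Finset.sum_comm (γ := Fin m)]
    exact Finset.sum_congr rfl fun p _ => Finset.sum_comm
  have h2 : E (∑ p, s p ^ 2) = ∑ r, ∑ p, v r p ^ 2 := by
    simp only [map_sum, sq, hGB]
    exact Finset.sum_comm
  rw [h1, h2, Finset.mul_sum]
  exact Finset.sum_le_sum fun r _ => hZ _

end SpherePE

/-! ### Point evaluations and attainment of the optimal value -/

theorem IsSpherePseudoExpectation.exists_extension {n : ℕ} {L : PolyLE n 4 →ₗ[ℝ] ℝ}
    (hL : IsSpherePseudoExpectation L) :
    ∃ E : MvPolynomial (Fin n) ℝ →ₗ[ℝ] ℝ, SpherePE E ∧ ∀ p (h : p ∈ PolyLE n 4), L ⟨p, h⟩ = E p := by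
  obtain ⟨E, hE⟩ := LinearMap.exists_extend L
  have key : ∀ p (h : p ∈ PolyLE n 4), L ⟨p, h⟩ = E p := fun p h => by rw [← hE]; rfl
  refine ⟨E, ⟨?_, fun p hp => ?_, fun q hq => ?_⟩, key⟩
  · rw [← key _ (one_mem_polyLE n 4), hL.1.map_one]
  · rw [← key _ (sq_mem_polyLE (d := 4) hp)]
    exact hL.1.sq_nonneg p hp
  · have h : spherePoly n * q ∈ PolyLE n 4 := by
      rw [MvPolynomial.mem_restrictTotalDegree]
      exact totalDegree_mul_le (a := 2) (b := 2) spherePoly_totalDegree hq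
    rw [← key _ h]
    exact hL.2 q h

/-- Evaluation at a point `x`, as a functional on polynomials of degree at most `4`. -/
noncomputable def evalFunctional {n : ℕ} (x : EuclideanSpace ℝ (Fin n)) : PolyLE n 4 →ₗ[ℝ] ℝ :=
  (MvPolynomial.aeval (R := ℝ) x.ofLp).toLinearMap ∘ₗ (PolyLE n 4).subtype

theorem evalFunctional_apply {n : ℕ} (x : EuclideanSpace ℝ (Fin n)) (p : MvPolynomial (Fin n) ℝ)
    (h : p ∈ PolyLE n 4) : evalFunctional x ⟨p, h⟩ = MvPolynomial.eval x.ofLp p := by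
  simp [evalFunctional, MvPolynomial.aeval_eq_eval]

theorem isSpherePseudoExpectation_evalFunctional {n : ℕ} {x : EuclideanSpace ℝ (Fin n)}
    (hx : ‖x‖ = 1) : IsSpherePseudoExpectation (evalFunctional x) := by
  refine ⟨⟨?_, fun p hp => ?_⟩, fun q h => ?_⟩
  · rw [evalFunctional_apply, map_one]
  · rw [evalFunctional_apply, map_pow]
    exact sq_nonneg _
  · have hs : ∑ i, x i ^ 2 = 1 := by
      rw [← EuclideanSpace.real_norm_sq_eq, hx, one_pow]
    rw [evalFunctional_apply, map_mul, spherePoly]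
    simp [hs]

namespace SpherePE

variable {n : ℕ} {E : MvPolynomial (Fin n) ℝ →ₗ[ℝ] ℝ}

/-- Multiplication by `‖x‖²` does not change pseudo-expectations. -/
theorem normSq_mul (hE : SpherePE E) {q : MvPolynomial (Fin n) ℝ} (hq : q.totalDegree ≤ 2) :
    E ((∑ i, MvPolynomial.X i ^ 2) * q) = E q := by
  have h := hE.sphere q hq
  rw [spherePoly, sub_mul, one_mul, map_sub] at h
  linarith

theorem X_mul_sq_le (hE : SpherePE E) (i : Fin n) {q : MvPolynomial (Fin n) ℝ}
    (hq : q.totalDegree ≤ 1) : E ((MvPolynomial.X i * q) ^ 2) ≤ E (q ^ 2) := by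
  have hq2 : (q ^ 2).totalDegree ≤ 2 := by
    rw [sq]; exact totalDegree_mul_le hq hq
  rw [← hE.normSq_mul hq2, Finset.sum_mul, map_sum]
  have e : ∀ j, MvPolynomial.X j ^ 2 * q ^ 2 = (MvPolynomial.X j * q) ^ 2 := fun j => by ring
  simp only [e]
  refine Finset.single_le_sum (f := fun j => E ((MvPolynomial.X j * q) ^ 2)) (fun j _ => ?_)
    (Finset.mem_univ i)
  exact hE.sq_nonneg _ (totalDegree_mul_le (a := 1) (b := 1) (by simp) hq)

theorem degree_sum_eq (a : Fin n →₀ ℕ) : (a.sum fun _ => id) = a.degree := rfl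

theorem monomial_sq_le (hE : SpherePE E) : ∀ (k : ℕ), k ≤ 2 → ∀ a : Fin n →₀ ℕ, a.degree = k →
    E (MvPolynomial.monomial a 1 ^ 2) ≤ 1 := by
  intro k
  induction k with
  | zero =>
    intro _ a ha
    rw [Finsupp.degree_eq_zero_iff] at ha
    subst ha
    rw [MvPolynomial.monomial_zero', MvPolynomial.C_1, one_pow, hE.map_one]
  | succ k ih =>
    intro hk a ha
    obtain ⟨i, hi⟩ : ∃ i, a i ≠ 0 := by
      by_contra! h
      have : a = 0 := Finsupp.ext h
      simp [this] at ha
    have hle : Finsupp.single i 1 ≤ a := by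
      rw [Finsupp.single_le_iff]; omega
    have hsplit : a = Finsupp.single i 1 + (a - Finsupp.single i 1) :=
      (add_tsub_cancel_of_le hle).symm
    set b := a - Finsupp.single i 1
    have hb : b.degree = k := by
      have := congrArg Finsupp.degree hsplit
      rw [map_add, Finsupp.degree_single] at this
      omega
    have e : (MvPolynomial.monomial a (1 : ℝ)) = MvPolynomial.X i * MvPolynomial.monomial b 1 := by
      rw [hsplit, MvPolynomial.X, MvPolynomial.monomial_mul, one_mul]
    rw [e]
    refine (hE.X_mul_sq_le i ?_).trans (ih (by omega) b hb)
    refine (MvPolynomial.totalDegree_monomial_le _ _).trans ?_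
    rw [degree_sum_eq, hb]
    omega

/-- Pseudo-moments of degree at most `4` are bounded by `1`: a monomial is a product of two
monomials of degree at most `2`. -/
theorem abs_monomial_le (hE : SpherePE E) (a : Fin n →₀ ℕ) (ha : a.degree ≤ 4) :
    |E (MvPolynomial.monomial a 1)| ≤ 1 := by
  obtain ⟨b, hba, hb⟩ := Finsupp.exists_le_degree_eq a (min 2 a.degree) (min_le_right _ _)
  obtain ⟨c, rfl⟩ := exists_add_of_le hba
  rw [map_add] at ha hb
  have hb2 : b.degree ≤ 2 := hb.le.trans (min_le_left _ _)
  have hc2 : c.degree ≤ 2 := by omega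
  have dle : ∀ d : Fin n →₀ ℕ, d.degree ≤ 2 →
      (MvPolynomial.monomial d (1 : ℝ)).totalDegree ≤ 2 := fun d hd =>
    (MvPolynomial.totalDegree_monomial_le _ _).trans (by rwa [degree_sum_eq])
  have h := hE.cauchySchwarz (κ := Unit) (p := fun _ => MvPolynomial.monomial b 1)
    (q := fun _ => MvPolynomial.monomial c 1) (fun _ => dle b hb2) (fun _ => dle c hc2)
  simp only [Finset.univ_unique, Finset.sum_singleton, MvPolynomial.monomial_mul, one_mul] at h
  rw [← sq_le_one_iff_abs_le_one]
  exact h.trans (mul_le_one₀ (hE.monomial_sq_le _ hb2 b rfl) (hE.sq_nonneg _ (dle c hc2))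
    (hE.monomial_sq_le _ hc2 c rfl))

theorem abs_le_sum_coeff (hE : SpherePE E) {p : MvPolynomial (Fin n) ℝ} (hp : p ∈ PolyLE n 4) :
    |E p| ≤ ∑ d ∈ p.support, |p.coeff d| := by
  conv_lhs => rw [p.as_sum]
  rw [map_sum]
  refine (Finset.abs_sum_le_sum_abs _ _).trans (Finset.sum_le_sum fun d hd => ?_)
  rw [MvPolynomial.mem_restrictTotalDegree] at hp
  have hd4 : d.degree ≤ 4 := (MvPolynomial.le_totalDegree hd).trans hp
  have e : MvPolynomial.monomial d (p.coeff d) =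
      MvPolynomial.C (p.coeff d) * MvPolynomial.monomial d 1 := by
    rw [MvPolynomial.C_mul_monomial, mul_one]
  rw [e, C_mul, abs_mul]
  exact mul_le_of_le_one_right (abs_nonneg _) (hE.abs_monomial_le d hd4)

end SpherePE

/-- The relaxation attains its maximum: in coordinates with respect to a basis of the polynomials of
degree at most `4`, the pseudo-expectations on the sphere form a nonempty compact set. -/
theorem exists_isOptimal {n : ℕ} (hn : 0 < n) (p : PolyLE n 4) :
    ∃ L : PolyLE n 4 →ₗ[ℝ] ℝ, IsOptimal L p := by
  let b := Module.finBasis ℝ (PolyLE n 4)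
  let F : (Fin (Module.finrank ℝ (PolyLE n 4)) → ℝ) → PolyLE n 4 →ₗ[ℝ] ℝ := fun c => b.constr ℝ c
  have hF : ∀ q, Continuous fun c => F c q := by
    intro q
    simp only [F, Module.Basis.constr_apply_fintype]
    fun_prop
  have hsurj : ∀ L, ∃ c, F c = L ∧ ∀ i, c i = L (b i) := fun L =>
    ⟨fun i => L (b i), (b.constr ℝ).apply_symm_apply L, fun _ => rfl⟩
  let K := {c | IsSpherePseudoExpectation (F c)}
  have hclosed : IsClosed K := by
    have : K = {c | F c ⟨1, one_mem_polyLE n 4⟩ = 1} ∩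
        (⋂ (q : MvPolynomial (Fin n) ℝ) (hq : q.totalDegree ≤ 4 / 2),
          {c | 0 ≤ F c ⟨q ^ 2, sq_mem_polyLE hq⟩}) ∩
        ⋂ (q : MvPolynomial (Fin n) ℝ) (h : spherePoly n * q ∈ PolyLE n 4),
          {c | F c ⟨spherePoly n * q, h⟩ = 0} := by
      ext c
      simp only [K, Set.mem_ofPred_eq, Set.mem_inter_iff, Set.mem_iInter]
      exact ⟨fun h => ⟨⟨h.1.1, h.1.2⟩, h.2⟩, fun h => ⟨⟨h.1.1, h.1.2⟩, h.2⟩⟩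
    rw [this]
    refine ((isClosed_eq (hF _) continuous_const).inter ?_).inter ?_
    · exact isClosed_iInter fun q => isClosed_iInter fun hq =>
        isClosed_le continuous_const (hF _)
    · exact isClosed_iInter fun q => isClosed_iInter fun hq =>
        isClosed_eq (hF _) continuous_const
  let B : Fin (Module.finrank ℝ (PolyLE n 4)) → ℝ := fun i =>
    ∑ d ∈ (b i).1.support, |(b i).1.coeff d|
  have hbdd : K ⊆ Set.Icc (-B) B := by
    intro c hc
    obtain ⟨E, hE, hLE⟩ := IsSpherePseudoExpectation.exists_extension hc
    have h : ∀ i, |c i| ≤ B i := by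
      intro i
      have e : c i = E (b i).1 := by
        rw [← hLE _ (b i).2]
        exact (b.constr_basis ℝ c i).symm
      rw [e]
      exact hE.abs_le_sum_coeff (b i).2
    exact ⟨fun i => (abs_le.mp (h i)).1, fun i => (abs_le.mp (h i)).2⟩
  have hcompact : IsCompact K := isCompact_Icc.of_isClosed_subset hclosed hbdd
  have hne : K.Nonempty := by
    obtain ⟨c, hc, -⟩ := hsurj (evalFunctional (EuclideanSpace.single ⟨0, hn⟩ 1))
    refine ⟨c, ?_⟩
    change IsSpherePseudoExpectation (F c)
    rw [hc]
    exact isSpherePseudoExpectation_evalFunctional (by simp)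
  obtain ⟨c, hcK, hc⟩ := hcompact.exists_isMaxOn hne (hF p).continuousOn
  refine ⟨F c, hcK, fun L' hL' => ?_⟩
  obtain ⟨c', rfl, -⟩ := hsurj L'
  exact hc hL'

theorem eval_tensorPoly {n : ℕ} (T : Tensor n) (x : EuclideanSpace ℝ (Fin n)) :
    MvPolynomial.eval x.ofLp (tensorPoly T) = tensorEval T x := by
  simp [tensorPoly, tensorEval]

theorem eval_linearPoly {n : ℕ} (v x : EuclideanSpace ℝ (Fin n)) :
    MvPolynomial.eval x.ofLp (linearPoly v) = inner ℝ v x := by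
  simp [linearPoly, PiLp.inner_apply, mul_comm]

/-- A certified bound holds at every point of the sphere, since point evaluations are feasible. -/
theorem Certifies.tensorEval_le {n : ℕ} {Θ τ : ℝ} {T : Tensor n} {v : EuclideanSpace ℝ (Fin n)}
    (h : Certifies Θ τ T v) {x : EuclideanSpace ℝ (Fin n)} (hx : ‖x‖ = 1) :
    tensorEval T x ≤ τ * inner ℝ v x ^ 3 + Θ * rate n := by
  obtain ⟨L, ⟨-, hopt⟩, hL⟩ := h
  have := (hopt _ (isSpherePseudoExpectation_evalFunctional hx)).trans hL
  rw [certificationObjective, evalFunctional_apply, map_sub, map_mul, map_pow, eval_tensorPoly,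
    eval_linearPoly, MvPolynomial.eval_C] at this
  linarith

/-! ### Cubic forms with bounded slices -/

/-- The trilinear form with coefficients `a`, on vectors of polynomials. -/
noncomputable def triForm {n : ℕ} (a : Fin n → Fin n → Fin n → ℝ)
    (u w y : Fin n → MvPolynomial (Fin n) ℝ) : MvPolynomial (Fin n) ℝ :=
  ∑ i, ∑ j, ∑ k, MvPolynomial.C (a i j k) * (u i * w j * y k)

/-- The quadratic form `⟨y, a_i y⟩` of the `i`-th slice of `a`. -/
noncomputable def sliceForm {n : ℕ} (a : Fin n → Fin n → Fin n → ℝ)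
    (y : Fin n → MvPolynomial (Fin n) ℝ) (i : Fin n) : MvPolynomial (Fin n) ℝ :=
  ∑ j, ∑ k, MvPolynomial.C (a i j k) * (y j * y k)

/-- Every degree-`4` pseudo-expectation satisfies `∑ᵢ ⟨y, aᵢ y⟩² ≤ R² ‖y‖⁴`, for all `y` that are
affine in the variables `x`. -/
def SliceBound {n : ℕ} (a : Fin n → Fin n → Fin n → ℝ) (R : ℝ) : Prop :=
  ∀ E : MvPolynomial (Fin n) ℝ →ₗ[ℝ] ℝ, SpherePE E →
    ∀ y : Fin n → MvPolynomial (Fin n) ℝ, (∀ i, (y i).totalDegree ≤ 1) →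
      E (∑ i, sliceForm a y i ^ 2) ≤ R ^ 2 * E ((∑ i, y i ^ 2) ^ 2)

section triForm

variable {n : ℕ} {a : Fin n → Fin n → Fin n → ℝ}

theorem triForm_add_left (u u' w y : Fin n → MvPolynomial (Fin n) ℝ) :
    triForm a (u + u') w y = triForm a u w y + triForm a u' w y := by
  simp only [triForm, Pi.add_apply, add_mul, mul_add, Finset.sum_add_distrib]

theorem triForm_swap_left (h : ∀ i j k, a i j k = a j i k)
    (u w y : Fin n → MvPolynomial (Fin n) ℝ) : triForm a u w y = triForm a w u y := by
  unfold triForm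
  rw [Finset.sum_comm]
  refine Finset.sum_congr rfl fun i _ => Finset.sum_congr rfl fun j _ =>
    Finset.sum_congr rfl fun k _ => ?_
  rw [h j i k]
  ring

theorem triForm_swap_right (h : ∀ i j k, a i j k = a i k j)
    (u w y : Fin n → MvPolynomial (Fin n) ℝ) : triForm a u w y = triForm a u y w := by
  unfold triForm
  refine Finset.sum_congr rfl fun i _ => ?_
  rw [Finset.sum_comm]
  refine Finset.sum_congr rfl fun j _ => Finset.sum_congr rfl fun k _ => ?_
  rw [h i k j]
  ring

theorem triForm_eq_sum_mul_sliceForm (u y : Fin n → MvPolynomial (Fin n) ℝ) :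
    triForm a u y y = ∑ i, u i * sliceForm a y i := by
  simp only [triForm, sliceForm, Finset.mul_sum]
  refine Finset.sum_congr rfl fun i _ => Finset.sum_congr rfl fun j _ =>
    Finset.sum_congr rfl fun k _ => ?_
  ring

/-- The increment of a cubic form along `z`, written so that only terms of the shape
`∑ᵢ zᵢ ⟨y, aᵢ y⟩` occur. -/
theorem triForm_increment (h₁ : ∀ i j k, a i j k = a j i k) (h₂ : ∀ i j k, a i j k = a i k j)
    (v z : Fin n → MvPolynomial (Fin n) ℝ) :
    2 * (triForm a (v + z) (v + z) (v + z) - triForm a v v v) =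
      3 * triForm a z v v + 3 * triForm a z (v + z) (v + z) - triForm a z z z := by
  have mid : ∀ u w w' y, triForm a u (w + w') y = triForm a u w y + triForm a u w' y := by
    intro u w w' y
    rw [triForm_swap_left h₁, triForm_add_left, triForm_swap_left h₁ w, triForm_swap_left h₁ w']
  have right : ∀ u w y y', triForm a u w (y + y') = triForm a u w y + triForm a u w y' := by
    intro u w y y'
    rw [triForm_swap_right h₂, mid, triForm_swap_right h₂ u y, triForm_swap_right h₂ u y']
  simp only [triForm_add_left, mid, right]
  rw [triForm_swap_right h₂ v z v, triForm_swap_left h₁ v v z, triForm_swap_right h₂ v v z,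
    triForm_swap_left h₁ v z v, triForm_swap_right h₂ z z v, triForm_swap_left h₁ v z z]
  ring

theorem sliceForm_totalDegree {y : Fin n → MvPolynomial (Fin n) ℝ}
    (hy : ∀ i, (y i).totalDegree ≤ 1) (i : Fin n) : (sliceForm a y i).totalDegree ≤ 2 :=
  totalDegree_sum_le _ _ fun j _ => totalDegree_sum_le _ _ fun k _ =>
    totalDegree_C_mul_le _ (totalDegree_mul_le (hy j) (hy k))

theorem SliceBound.abs_triForm_le {R : ℝ} (hR : 0 ≤ R) (ha : SliceBound a R)
    {E : MvPolynomial (Fin n) ℝ →ₗ[ℝ] ℝ} (hE : SpherePE E)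
    {z y : Fin n → MvPolynomial (Fin n) ℝ} (hz : ∀ i, (z i).totalDegree ≤ 1)
    (hy : ∀ i, (y i).totalDegree ≤ 1) :
    |E (triForm a z y y)| ≤ √(E (∑ i, z i ^ 2)) * (R * √(E ((∑ i, y i ^ 2) ^ 2))) := by
  rw [triForm_eq_sum_mul_sliceForm]
  refine (hE.cauchySchwarz_sqrt (fun i => (hz i).trans one_le_two)
    (sliceForm_totalDegree hy)).trans ?_
  refine mul_le_mul_of_nonneg_left ?_ (Real.sqrt_nonneg _)
  refine (Real.sqrt_le_sqrt (ha E hE y hy)).trans_eq ?_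
  rw [Real.sqrt_mul (sq_nonneg R), Real.sqrt_sq hR]

end triForm

namespace SpherePE

variable {n : ℕ} {E : MvPolynomial (Fin n) ℝ →ₗ[ℝ] ℝ}

theorem map_normSq (hE : SpherePE E) : E (∑ i, MvPolynomial.X i ^ 2) = 1 := by
  have := hE.normSq_mul (q := 1) (by simp)
  rwa [mul_one, hE.map_one] at this

theorem normSq_totalDegree : (∑ i, MvPolynomial.X i ^ 2 : MvPolynomial (Fin n) ℝ).totalDegree ≤ 2 :=
  totalDegree_sum_le _ _ fun i _ => by rw [MvPolynomial.totalDegree_X_pow]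

theorem map_normSq_sq (hE : SpherePE E) : E ((∑ i, MvPolynomial.X i ^ 2) ^ 2) = 1 := by
  rw [sq, hE.normSq_mul normSq_totalDegree, hE.map_normSq]

theorem sum_C_sq (u : EuclideanSpace ℝ (Fin n)) :
    (∑ i, MvPolynomial.C (u i) ^ 2 : MvPolynomial (Fin n) ℝ) = MvPolynomial.C (‖u‖ ^ 2) := by
  rw [EuclideanSpace.real_norm_sq_eq, map_sum]
  simp only [map_pow]

/-- `⟨u, x⟩² ≤ ‖u‖²` on the sphere, multiplied by the square of an affine polynomial. -/
theorem linearPoly_sq_mul_le (hE : SpherePE E) (u : EuclideanSpace ℝ (Fin n))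
    {w : MvPolynomial (Fin n) ℝ} (hw : w.totalDegree ≤ 1) :
    E (linearPoly u ^ 2 * w ^ 2) ≤ ‖u‖ ^ 2 * E (w ^ 2) := by
  rcases eq_or_ne u 0 with rfl | hu
  · simp [linearPoly]
  have hs : 0 < ‖u‖ ^ 2 := by positivity
  set s := ‖u‖ ^ 2 with hs'
  have hw2 : (w ^ 2).totalDegree ≤ 2 := by
    rw [sq]; exact totalDegree_mul_le hw hw
  have h := hE.sum_sq_nonneg (p := fun i =>
      (MvPolynomial.C s * MvPolynomial.X i - MvPolynomial.C (u i) * linearPoly u) * w) fun i =>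
    totalDegree_mul_le (a := 1) (b := 1)
      (totalDegree_sub_le (totalDegree_C_mul_le _ (by simp))
        (totalDegree_C_mul_le _ (linearPoly_totalDegree u))) hw
  have e : (∑ i, ((MvPolynomial.C s * MvPolynomial.X i - MvPolynomial.C (u i) * linearPoly u) * w)
      ^ 2) = MvPolynomial.C (s * s) * ((∑ i, MvPolynomial.X i ^ 2) * w ^ 2)
        - MvPolynomial.C s * (linearPoly u ^ 2 * w ^ 2) := by
    have e1 : ∀ i : Fin n,
        ((MvPolynomial.C s * MvPolynomial.X i - MvPolynomial.C (u i) * linearPoly u) * w) ^ 2 =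
        MvPolynomial.C s ^ 2 * w ^ 2 * MvPolynomial.X i ^ 2
          - 2 * MvPolynomial.C s * linearPoly u * w ^ 2 * (MvPolynomial.C (u i) * MvPolynomial.X i)
          + linearPoly u ^ 2 * w ^ 2 * MvPolynomial.C (u i) ^ 2 := fun i => by ring
    rw [Finset.sum_congr rfl fun i _ => e1 i, Finset.sum_add_distrib, Finset.sum_sub_distrib,
      ← Finset.mul_sum, ← Finset.mul_sum, ← Finset.mul_sum, sum_C_sq, ← hs', map_mul]
    change _ - _ * linearPoly u + _ = _
    ring
  rw [e, map_sub, C_mul, C_mul, hE.normSq_mul hw2] at h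
  have h' : 0 ≤ s * (s * E (w ^ 2) - E (linearPoly u ^ 2 * w ^ 2)) := by linarith
  have := nonneg_of_mul_nonneg_right h' hs
  linarith

theorem linearPoly_sq_le (hE : SpherePE E) (u : EuclideanSpace ℝ (Fin n)) :
    E (linearPoly u ^ 2) ≤ ‖u‖ ^ 2 := by
  have := hE.linearPoly_sq_mul_le u (w := 1) (by simp)
  simpa [hE.map_one] using this

theorem sq_map_le (hE : SpherePE E) {p : MvPolynomial (Fin n) ℝ} (hp : p.totalDegree ≤ 2) :
    E p ^ 2 ≤ E (p ^ 2) := by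
  have := hE.cauchySchwarz (κ := Unit) (p := fun _ => p) (q := fun _ => 1) (fun _ => hp)
    (fun _ => by simp)
  simpa [hE.map_one] using this

theorem abs_map_linearPoly_le (hE : SpherePE E) (u : EuclideanSpace ℝ (Fin n)) :
    |E (linearPoly u)| ≤ ‖u‖ :=
  abs_le_of_sq_le_sq ((hE.sq_map_le ((linearPoly_totalDegree u).trans one_le_two)).trans
    (hE.linearPoly_sq_le u)) (norm_nonneg u)

/-- `E (1 - t³) ≥ 3/4 · E (1 - t)` for `t = ⟨v, x⟩`, a sum-of-squares consequence of `t² ≤ 1`. -/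
theorem one_sub_linearPoly_cube (hE : SpherePE E) {v : EuclideanSpace ℝ (Fin n)} (hv : ‖v‖ = 1) :
    3 / 4 * (1 - E (linearPoly v)) ≤ 1 - E (linearPoly v ^ 3) := by
  set t := linearPoly v with ht
  have hd : t.totalDegree ≤ 1 := linearPoly_totalDegree v
  have hw : (t + MvPolynomial.C (1 / 2)).totalDegree ≤ 1 := totalDegree_add_le hd (by simp)
  have h1 := hE.sq_nonneg ((1 - t) * (t + MvPolynomial.C (1 / 2)))
    (totalDegree_mul_le (a := 1) (b := 1) (totalDegree_sub_le (by simp) hd) hw)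
  have h2 := hE.linearPoly_sq_mul_le v hw
  rw [← ht, hv, one_pow, one_mul] at h2
  have hC : (MvPolynomial.C (1 / 2) : MvPolynomial (Fin n) ℝ) * 2 = 1 := by
    rw [← map_ofNat MvPolynomial.C 2, ← map_mul]
    norm_num
  -- `2 (1 - t³) - (3/2) (1 - t) = ((1 - t) (t + 1/2))² + (1 - t²) (t + 1/2)²`
  have e : MvPolynomial.C 2 * (1 - t ^ 3) - MvPolynomial.C (3 / 2) * (1 - t) =
      ((1 - t) * (t + MvPolynomial.C (1 / 2))) ^ 2 +
        ((t + MvPolynomial.C (1 / 2)) ^ 2 - t ^ 2 * (t + MvPolynomial.C (1 / 2)) ^ 2) := by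
    have e3 : (MvPolynomial.C (3 / 2) : MvPolynomial (Fin n) ℝ) = 3 * MvPolynomial.C (1 / 2) := by
      rw [← map_ofNat MvPolynomial.C 3, ← map_mul]
      norm_num
    have e2 : (MvPolynomial.C 2 : MvPolynomial (Fin n) ℝ) = 2 := map_ofNat MvPolynomial.C 2
    rw [e3, e2]
    linear_combination (-(1 - t) * (2 * t + 2 + MvPolynomial.C (1 / 2 : ℝ))) * hC
  have := congrArg E e
  simp only [map_sub, map_add, C_mul, hE.map_one] at this
  linarith

/-- By Cauchy–Schwarz for the factorization `a³ - b³ = (a - b) (a² + a b + b²)`. -/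
theorem map_cube_sub_cube_le (hE : SpherePE E) {v w : EuclideanSpace ℝ (Fin n)} (hv : ‖v‖ ≤ 1)
    (hw : ‖w‖ ≤ 1) : E (linearPoly v ^ 3) - E (linearPoly w ^ 3) ≤ 3 * ‖v - w‖ := by
  have hsub : linearPoly (v - w) = linearPoly v - linearPoly w := by
    simp [linearPoly, sub_mul, Finset.sum_sub_distrib]
  have hd := hE.linearPoly_sq_le (v - w)
  set a := linearPoly v with ha
  set b := linearPoly w with hb
  have hda : a.totalDegree ≤ 1 := linearPoly_totalDegree v
  have hdb : b.totalDegree ≤ 1 := linearPoly_totalDegree w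
  have haa : (a * a).totalDegree ≤ 2 := totalDegree_mul_le hda hda
  have hab : (a * b).totalDegree ≤ 2 := totalDegree_mul_le hda hdb
  have hbb : (b * b).totalDegree ≤ 2 := totalDegree_mul_le hdb hdb
  have hq : (a * a + a * b + b * b).totalDegree ≤ 2 :=
    totalDegree_add_le (totalDegree_add_le haa hab) hbb
  have four : ∀ u : EuclideanSpace ℝ (Fin n), ‖u‖ ≤ 1 → E (linearPoly u ^ 4) ≤ 1 := by
    intro u hu
    have h1 := hE.linearPoly_sq_mul_le u (linearPoly_totalDegree u)
    have h2 := hE.linearPoly_sq_le u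
    rw [← pow_add] at h1
    have h3 : ‖u‖ ^ 2 ≤ 1 := pow_le_one₀ (norm_nonneg u) hu
    have h4 := hE.sq_nonneg (linearPoly u) ((linearPoly_totalDegree u).trans one_le_two)
    refine h1.trans (mul_le_one₀ h3 h4 (h2.trans h3))
  have ha4 := four v hv
  have hb4 := four w hw
  rw [← ha] at ha4
  rw [← hb] at hb4
  have hq9 : E ((a * a + a * b + b * b) ^ 2) ≤ 9 := by
    have s1 := hE.sq_nonneg (a * a - a * b) (totalDegree_sub_le haa hab)
    have s2 := hE.sq_nonneg (a * b - b * b) (totalDegree_sub_le hab hbb)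
    have s3 := hE.sq_nonneg (a * a - b * b) (totalDegree_sub_le haa hbb)
    have e : MvPolynomial.C 2 * (a * a + a * b + b * b) ^ 2 +
        MvPolynomial.C 2 * (a * a - a * b) ^ 2 + MvPolynomial.C 2 * (a * b - b * b) ^ 2
        + MvPolynomial.C 5 * (a * a - b * b) ^ 2 =
        MvPolynomial.C 9 * a ^ 4 + MvPolynomial.C 9 * b ^ 4 := by
      simp only [map_ofNat]
      ring
    have := congrArg E e
    simp only [map_add, C_mul] at this
    linarith
  have hcs := hE.cauchySchwarz_sqrt (κ := Unit) (p := fun _ => a - b)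
    (q := fun _ => a * a + a * b + b * b)
    (fun _ => (totalDegree_sub_le hda hdb).trans one_le_two) (fun _ => hq)
  simp only [Finset.univ_unique, Finset.sum_singleton] at hcs
  have e : (a - b) * (a * a + a * b + b * b) = a ^ 3 - b ^ 3 := by ring
  rw [e, map_sub, ← hsub] at hcs
  refine (le_abs_self _).trans (hcs.trans ?_)
  have h1 : √(E (linearPoly (v - w) ^ 2)) ≤ ‖v - w‖ := Real.sqrt_le_iff.mpr ⟨norm_nonneg _, hd⟩
  have h2 : √(E ((a * a + a * b + b * b) ^ 2)) ≤ 3 :=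
    Real.sqrt_le_iff.mpr ⟨by norm_num, by linarith⟩
  calc _ ≤ ‖v - w‖ * 3 := mul_le_mul h1 h2 (Real.sqrt_nonneg _) (norm_nonneg _)
    _ = _ := mul_comm _ _

/-- For a symmetric `a` with bounded slices, the cubic form at a pseudo-distribution exceeds its
value at a unit vector `v` by at most a constant times `R √(E ‖x - v‖²)`. -/
theorem triForm_sub_le (hE : SpherePE E) {a : Fin n → Fin n → Fin n → ℝ} {R : ℝ} (hR : 0 ≤ R)
    (ha : SliceBound a R) (h₁ : ∀ i j k, a i j k = a j i k) (h₂ : ∀ i j k, a i j k = a i k j)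
    {v : EuclideanSpace ℝ (Fin n)} (hv : ‖v‖ = 1) :
    E (triForm a MvPolynomial.X MvPolynomial.X MvPolynomial.X)
      - E (triForm a (fun i => MvPolynomial.C (v i)) (fun i => MvPolynomial.C (v i))
          (fun i => MvPolynomial.C (v i)))
      ≤ 5 * R * √(2 * (1 - E (linearPoly v))) := by
  set c : Fin n → MvPolynomial (Fin n) ℝ := fun i => MvPolynomial.C (v i) with hc
  set z : Fin n → MvPolynomial (Fin n) ℝ := MvPolynomial.X - c with hz
  set t := linearPoly v with ht
  have hd : t.totalDegree ≤ 1 := linearPoly_totalDegree v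
  have hX : ∀ i, (MvPolynomial.X i : MvPolynomial (Fin n) ℝ).totalDegree ≤ 1 := fun i => by simp
  have hcd : ∀ i, (c i).totalDegree ≤ 1 := fun i => by simp [hc]
  have hzd : ∀ i, (z i).totalDegree ≤ 1 := fun i => totalDegree_sub_le (hX i) (hcd i)
  have hc2 : ∑ i, c i ^ 2 = 1 := by
    rw [hc, sum_C_sq, hv, one_pow, MvPolynomial.C_1]
  have hz2 : ∑ i, z i ^ 2 = spherePoly n + MvPolynomial.C 2 * (1 - t) := by
    have e : ∀ i, z i ^ 2 = MvPolynomial.X i ^ 2 - 2 * (c i * MvPolynomial.X i) + c i ^ 2 :=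
      fun i => by simp only [hz, Pi.sub_apply]; ring
    rw [Finset.sum_congr rfl fun i _ => e i, Finset.sum_add_distrib, Finset.sum_sub_distrib,
      ← Finset.mul_sum, hc2, spherePoly]
    change _ - 2 * t + 1 = _
    rw [map_ofNat]
    ring
  have hEs : E (spherePoly n) = 0 := by
    have := hE.sphere 1 (by simp)
    rwa [mul_one] at this
  have hEz2 : E (∑ i, z i ^ 2) = 2 * (1 - E t) := by
    rw [hz2, map_add, hEs, C_mul, map_sub, hE.map_one, zero_add]
  have hEz4 : E ((∑ i, z i ^ 2) ^ 2) ≤ 16 := by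
    have e : (∑ i, z i ^ 2) ^ 2 = spherePoly n * (spherePoly n + MvPolynomial.C 4 * (1 - t))
        + MvPolynomial.C 4 * (1 - t) ^ 2 := by
      rw [hz2]
      simp only [map_ofNat]
      ring
    have hsd : (spherePoly n + MvPolynomial.C 4 * (1 - t)).totalDegree ≤ 2 :=
      totalDegree_add_le spherePoly_totalDegree
        (totalDegree_C_mul_le _ (totalDegree_sub_le (by simp) (hd.trans one_le_two)))
    rw [e, map_add, hE.sphere _ hsd, C_mul, zero_add]
    have h1 := hE.sq_nonneg (1 + t) (totalDegree_add_le (by simp) (hd.trans one_le_two))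
    have h2 := hE.linearPoly_sq_le v
    rw [← ht, hv, one_pow] at h2
    have e2 : (1 - t) ^ 2 + (1 + t) ^ 2 = MvPolynomial.C 2 * 1 + MvPolynomial.C 2 * t ^ 2 := by
      simp only [map_ofNat]
      ring
    have := congrArg E e2
    simp only [map_add, C_mul, hE.map_one] at this
    linarith
  have b1 := ha.abs_triForm_le hR hE hzd hcd
  have b2 := ha.abs_triForm_le hR hE hzd hX
  have b3 := ha.abs_triForm_le hR hE hzd hzd
  rw [hc2, one_pow, hE.map_one, Real.sqrt_one, mul_one] at b1
  rw [hE.map_normSq_sq, Real.sqrt_one, mul_one] at b2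
  have hs4 : √(E ((∑ i, z i ^ 2) ^ 2)) ≤ 4 := Real.sqrt_le_iff.mpr ⟨by norm_num, by linarith⟩
  have b3' : |E (triForm a z z z)| ≤ √(E (∑ i, z i ^ 2)) * (R * 4) :=
    b3.trans (mul_le_mul_of_nonneg_left (mul_le_mul_of_nonneg_left hs4 hR) (Real.sqrt_nonneg _))
  rw [hEz2] at b1 b2 b3'
  have inc := triForm_increment h₁ h₂ c z
  rw [show c + z = MvPolynomial.X by rw [hz]; abel] at inc
  have inc' : MvPolynomial.C 2 * (triForm a MvPolynomial.X MvPolynomial.X MvPolynomial.X -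
      triForm a c c c) = MvPolynomial.C 3 * triForm a z c c +
      MvPolynomial.C 3 * triForm a z MvPolynomial.X MvPolynomial.X - triForm a z z z := by
    simpa only [map_ofNat] using inc
  have := congrArg E inc'
  simp only [map_add, map_sub, C_mul] at this
  have := le_of_abs_le b1
  have := le_of_abs_le b2
  have := neg_le_of_abs_le b3'
  linarith

end SpherePE

/-! ### Analysis of the algorithms for noise with bounded slices -/

/-- The cubic form of the tensor `A` is the form of a symmetric tensor whose slices satisfy
`SliceBound` with constant `R`. -/
def CubicBound {n : ℕ} (A : Tensor n) (R : ℝ) : Prop :=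
  ∃ a : Fin n → Fin n → Fin n → ℝ, (∀ i j k, a i j k = a j i k) ∧ (∀ i j k, a i j k = a i k j) ∧
    SliceBound a R ∧ tensorPoly A = triForm a MvPolynomial.X MvPolynomial.X MvPolynomial.X

theorem tensorPoly_spiked {n : ℕ} (τ : ℝ) (v₀ : EuclideanSpace ℝ (Fin n)) (A : Tensor n) :
    tensorPoly (spiked τ v₀ A) = MvPolynomial.C τ * linearPoly v₀ ^ 3 + tensorPoly A := by
  simp only [tensorPoly, linearPoly, Fintype.sum_pow, Finset.mul_sum, spiked, tensorCube,
    ← Finset.sum_add_distrib, Finset.prod_mul_distrib, map_add, map_mul, map_prod]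
  exact Finset.sum_congr rfl fun α _ => by ring

theorem triForm_C {n : ℕ} (a : Fin n → Fin n → Fin n → ℝ) (v : EuclideanSpace ℝ (Fin n)) :
    triForm a (fun i => MvPolynomial.C (v i)) (fun i => MvPolynomial.C (v i))
      (fun i => MvPolynomial.C (v i)) =
    MvPolynomial.C (MvPolynomial.eval v.ofLp
      (triForm a MvPolynomial.X MvPolynomial.X MvPolynomial.X)) := by
  simp [triForm]

theorem inner_pseudoMean {n : ℕ} {L : PolyLE n 4 →ₗ[ℝ] ℝ} {E : MvPolynomial (Fin n) ℝ →ₗ[ℝ] ℝ}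
    (hLE : ∀ p (h : p ∈ PolyLE n 4), L ⟨p, h⟩ = E p) (u : EuclideanSpace ℝ (Fin n)) :
    inner ℝ (pseudoMean L) u = E (linearPoly u) := by
  simp [pseudoMean, linearPoly, PiLp.inner_apply, SpherePE.C_mul, hLE]

theorem norm_pseudoMean_le {n : ℕ} {L : PolyLE n 4 →ₗ[ℝ] ℝ}
    {E : MvPolynomial (Fin n) ℝ →ₗ[ℝ] ℝ} (hE : SpherePE E)
    (hLE : ∀ p (h : p ∈ PolyLE n 4), L ⟨p, h⟩ = E p) : ‖pseudoMean L‖ ≤ 1 := by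
  have h1 := le_of_abs_le (hE.abs_map_linearPoly_le (pseudoMean L))
  rw [← inner_pseudoMean hLE, real_inner_self_eq_norm_sq, sq] at h1
  by_contra! h
  nlinarith

/-- Normalizing a vector of the unit ball at most doubles its distance, measured by the inner
product, to a unit vector; the junk value `0` of the normalization of `0` is covered. -/
theorem one_sub_inner_normalize_le {V : Type*} [NormedAddCommGroup V] [InnerProductSpace ℝ V]
    {m v₀ : V} (hm : ‖m‖ ≤ 1) (hv₀ : ‖v₀‖ = 1) {η : ℝ} (h : 1 - inner ℝ m v₀ ≤ η) :
    1 - inner ℝ (‖m‖⁻¹ • m) v₀ ≤ 2 * η := by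
  have hcs := abs_le.mp (abs_real_inner_le_norm m v₀)
  rw [hv₀, mul_one] at hcs
  rw [real_inner_smul_left]
  rcases eq_or_ne m 0 with rfl | hne
  · simp at h ⊢
    linarith
  have hpos : 0 < ‖m‖ := norm_pos_iff.mpr hne
  rcases le_total 0 (inner ℝ m v₀) with h0 | h0
  · have : inner ℝ m v₀ ≤ ‖m‖⁻¹ * inner ℝ m v₀ :=
      le_mul_of_one_le_left h0 ((one_le_inv₀ hpos).mpr hm)
    linarith
  · have : -1 ≤ ‖m‖⁻¹ * inner ℝ m v₀ := by
      rw [inv_mul_eq_div, le_div_iff₀ hpos]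
      linarith
    linarith

theorem norm_inv_smul_le_one {V : Type*} [NormedAddCommGroup V] [NormedSpace ℝ V] (m : V) :
    ‖‖m‖⁻¹ • m‖ ≤ 1 := by
  rw [norm_smul, norm_inv, norm_norm]
  exact inv_mul_le_one

section

variable {n : ℕ} {A : Tensor n} {R τ : ℝ} {v₀ v : EuclideanSpace ℝ (Fin n)}

/-- Comparing an optimal pseudo-distribution with the point `v₀`: the gain on the noise is at most
of order `R √η` by `triForm_sub_le`, the loss on the spike at least of order `τ η`, where
`η = Ẽ (1 - ⟨v₀, x⟩)`. Hence `η` is of order `(R / τ)²`. -/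
theorem CubicBound.one_sub_inner_le (hA : CubicBound A R) (hR : 0 ≤ R) (hτ : 0 < τ)
    (hv₀ : ‖v₀‖ = 1) (hv : IsRecoveryOutput (spiked τ v₀ A) v) :
    1 - inner ℝ v v₀ ≤ 200 * (R / τ) ^ 2 := by
  obtain ⟨L, ⟨hL, hopt⟩, rfl⟩ := hv
  obtain ⟨E, hE, hLE⟩ := hL.exists_extension
  obtain ⟨a, h₁, h₂, ha, hAa⟩ := hA
  have h := hopt _ (isSpherePseudoExpectation_evalFunctional hv₀)
  rw [recoveryObjective, evalFunctional_apply, hLE, tensorPoly_spiked, map_add, map_add,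
    SpherePE.C_mul, map_mul, map_pow, eval_linearPoly, MvPolynomial.eval_C,
    real_inner_self_eq_norm_sq, hv₀, hAa] at h
  have hsub := hE.triForm_sub_le hR ha h₁ h₂ hv₀
  rw [triForm_C, hE.map_C] at hsub
  have hcube := hE.one_sub_linearPoly_cube hv₀
  have hη0 : 0 ≤ 1 - E (linearPoly v₀) := by
    have := le_of_abs_le (hE.abs_map_linearPoly_le v₀)
    linarith
  set η := 1 - E (linearPoly v₀) with hη
  have hmain : τ * (3 / 4 * η) ≤ 5 * R * √(2 * η) := by
    have := mul_le_mul_of_nonneg_left hcube hτ.le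
    linarith
  have hbound : η ≤ 100 * (R / τ) ^ 2 := by
    have hs := Real.sq_sqrt (show 0 ≤ 2 * η by linarith)
    have hs0 := Real.sqrt_nonneg (2 * η)
    set s := √(2 * η) with hs'
    have hη2 : η = s ^ 2 / 2 := by linarith
    -- in terms of `s = √(2 η)`, the comparison reads `(3/8) τ s² ≤ 5 R s`
    have h3 : s ≤ 14 * (R / τ) := by
      rw [mul_div_assoc', le_div_iff₀ hτ]
      by_contra! hc
      have hsp : 0 < s := by
        by_contra! h0
        have : s = 0 := le_antisymm h0 hs0
        rw [this] at hc
        linarith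
      rw [hη2] at hmain
      have h5 : s * (3 / 8 * (s * τ)) ≤ s * (5 * R) := by linarith
      have h6 := le_of_mul_le_mul_left h5 hsp
      linarith
    have h4 : s ^ 2 ≤ (14 * (R / τ)) ^ 2 := pow_le_pow_left₀ hs0 h3 2
    have h7 := sq_nonneg (R / τ)
    rw [mul_pow] at h4
    linarith
  have := one_sub_inner_normalize_le (norm_pseudoMean_le hE hLE) hv₀
    (η := η) (by rw [inner_pseudoMean hLE])
  linarith

/-- By `CubicBound.one_sub_inner_le` the recovered vector is within `20 R / τ` of `v₀`, so the residual
spike contributes at most `60 R`, and the noise at most `R`. -/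
theorem CubicBound.certifies (hA : CubicBound A R) (hR : 0 ≤ R) (hτ : 0 < τ) (hn : 0 < n)
    (hv₀ : ‖v₀‖ = 1) (hv : IsRecoveryOutput (spiked τ v₀ A) v) {Θ : ℝ}
    (hΘ : 70 * R ≤ Θ * rate n) : Certifies Θ τ (spiked τ v₀ A) v := by
  have hinner := hA.one_sub_inner_le hR hτ hv₀ hv
  have hv1 : ‖v‖ ≤ 1 := by
    obtain ⟨L, -, rfl⟩ := hv
    exact norm_inv_smul_le_one _
  obtain ⟨L, hL⟩ := exists_isOptimal hn (certificationObjective τ (spiked τ v₀ A) v)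
  refine ⟨L, hL, le_trans ?_ hΘ⟩
  obtain ⟨E, hE, hLE⟩ := hL.1.exists_extension
  obtain ⟨a, h₁, h₂, ha, hAa⟩ := hA
  rw [certificationObjective, hLE, tensorPoly_spiked, map_sub, map_add, SpherePE.C_mul,
    SpherePE.C_mul, hAa]
  have hnoise := ha.abs_triForm_le hR hE (z := MvPolynomial.X) (y := MvPolynomial.X)
    (fun i => by simp) (fun i => by simp)
  rw [hE.map_normSq, hE.map_normSq_sq, Real.sqrt_one, mul_one, one_mul] at hnoise
  have hcube := hE.map_cube_sub_cube_le hv₀.le hv1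
  have hdist : ‖v₀ - v‖ ≤ 20 * (R / τ) := by
    refine le_of_sq_le_sq ?_ (by positivity)
    rw [norm_sub_sq_real, hv₀, real_inner_comm, mul_pow]
    have := pow_le_one₀ (n := 2) (norm_nonneg v) hv1
    linarith
  have h1 : τ * (E (linearPoly v₀ ^ 3) - E (linearPoly v ^ 3)) ≤ τ * (3 * (20 * (R / τ))) :=
    mul_le_mul_of_nonneg_left (hcube.trans (by linarith)) hτ.le
  have h2 : τ * (3 * (20 * (R / τ))) = 60 * R := by
    field_simp
    ring
  have := le_of_abs_le hnoise
  linarith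

end

/-! ### Bounds on slices from bounds on real multilinear forms -/

/-- The trilinear form `∑ aᵢⱼₖ uᵢ bⱼ cₖ` is at most `√K ‖u‖ ‖b‖ ‖c‖`, with the supremum over `u`
already taken. -/
def InjBound {ι : Type*} [Fintype ι] (a : ι → ι → ι → ℝ) (K : ℝ) : Prop :=
  ∀ b c : ι → ℝ, ∑ i, (∑ j, ∑ k, a i j k * (b j * c k)) ^ 2 ≤ K * (∑ j, b j ^ 2) * ∑ k, c k ^ 2

/-- The decoupled part of `∑ᵢ aᵢ ⊗ aᵢ`: the matrix with entries `∑ᵢ aᵢⱼₖ aᵢₗₘ` at `(j, l), (k, m)`,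
restricted to `j ∈ S` and `l ∉ S`. Subsets are encoded by their indicators. -/
def decoupled {ι : Type*} [Fintype ι] (a : ι → ι → ι → ℝ) (S : ι → Bool) (p q : ι × ι) : ℝ :=
  if S p.1 = true ∧ S p.2 = false then ∑ i, a i p.1 q.1 * a i p.2 q.2 else 0

theorem sum_sum_mul_sum {R α β : Type*} [CommSemiring R] [Fintype α] [Fintype β]
    (f g : α → β → R) :
    ∑ i, (∑ k, f i k) * ∑ m, g i m = ∑ k, ∑ m, ∑ i, f i k * g i m := by
  simp only [Finset.sum_mul_sum]
  rw [Finset.sum_comm]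
  exact Finset.sum_congr rfl fun k _ => Finset.sum_comm

/-- A distinct pair of indices is separated, in a given order, by one quarter of all subsets. -/
theorem four_mul_card_separating {ι : Type*} [Fintype ι] [DecidableEq ι] {j l : ι} (hjl : j ≠ l) :
    4 * (Finset.univ.filter fun S : ι → Bool => S j = true ∧ S l = false).card =
      2 ^ Fintype.card ι := by
  have h : (Finset.univ.filter fun S : ι → Bool => S j = true ∧ S l = false) =
      Fintype.piFinset fun i => if i = j then {true} else if i = l then {false} else Finset.univ := by
    ext S
    simp only [Finset.mem_filter, Finset.mem_univ, true_and, Fintype.mem_piFinset]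
    constructor
    · rintro ⟨h1, h2⟩ i
      split_ifs with hi hi'
      · simpa [hi] using h1
      · simpa [hi'] using h2
      · simp
    · intro h
      refine ⟨by simpa using h j, by simpa [hjl.symm] using h l⟩
  rw [h, Fintype.card_piFinset]
  have h4 : 4 = (∏ i : ι, if i = j then 2 else 1) * ∏ i : ι, if i = l then 2 else 1 := by
    simp
  rw [h4, ← Finset.prod_mul_distrib, ← Finset.prod_mul_distrib, ← Finset.card_univ,
    ← Finset.prod_const]
  refine Finset.prod_congr rfl fun i _ => ?_
  by_cases h1 : i = j
  · have : i ≠ l := h1 ▸ hjl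
    simp [h1, hjl]
  · by_cases h2 : i = l <;> simp [h1, h2, hjl.symm]

/-- The square of a sum, with the off-diagonal part averaged over separating subsets. -/
theorem two_pow_mul_sum_sq {ι R : Type*} [Fintype ι] [DecidableEq ι] [CommRing R] (u : ι → R) :
    2 ^ Fintype.card ι * (∑ j, u j) ^ 2 = 2 ^ Fintype.card ι * ∑ j, u j ^ 2 +
      4 * ∑ S : ι → Bool, ∑ j, ∑ l, if S j = true ∧ S l = false then u j * u l else 0 := by
  have h : ∑ S : ι → Bool, ∑ j, ∑ l, (if S j = true ∧ S l = false then u j * u l else 0) =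
      ∑ j, ∑ l, ((Finset.univ.filter fun S : ι → Bool => S j = true ∧ S l = false).card : R)
        * (u j * u l) := by
    rw [Finset.sum_comm]
    refine Finset.sum_congr rfl fun j _ => ?_
    rw [Finset.sum_comm]
    refine Finset.sum_congr rfl fun l _ => ?_
    rw [← Finset.sum_filter, Finset.sum_const, nsmul_eq_mul]
  rw [h, sq (∑ j, u j), Finset.sum_mul_sum]
  simp only [Finset.mul_sum, ← Finset.sum_add_distrib]
  refine Finset.sum_congr rfl fun j _ => ?_
  rw [← Finset.add_sum_erase _ _ (Finset.mem_univ j)]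
  conv_rhs => rw [← Finset.add_sum_erase _ _ (Finset.mem_univ j)]
  have h0 : (Finset.univ.filter fun S : ι → Bool => S j = true ∧ S j = false) = ∅ := by
    ext S; simp
  rw [h0]
  simp only [Finset.card_empty, Nat.cast_zero, zero_mul, mul_zero, zero_add]
  rw [← sq]
  congr 1
  refine Finset.sum_congr rfl fun l hl => ?_
  have := congrArg (Nat.cast (R := R)) (four_mul_card_separating (Finset.ne_of_mem_erase hl).symm)
  push_cast at this
  rw [← this, mul_assoc]

section

variable {n : ℕ} {a : Fin n → Fin n → Fin n → ℝ}

theorem InjBound.slice_le {K : ℝ} (ha : InjBound a K) (j : Fin n) (x : Fin n → ℝ) :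
    ∑ k, ∑ m, (∑ i, a i j k * a i j m) * (x k * x m) ≤ K * ∑ k, x k ^ 2 := by
  have h := ha (Pi.single j 1) x
  have e1 : ∀ i, ∑ j', ∑ k, a i j' k * ((Pi.single j 1 : Fin n → ℝ) j' * x k) =
      ∑ k, a i j k * x k := by
    intro i
    rw [Finset.sum_eq_single j]
    · simp
    · intro b _ hb
      simp [hb]
    · simp
  have e2 : ∑ j', (Pi.single j 1 : Fin n → ℝ) j' ^ 2 = 1 := by
    rw [Finset.sum_eq_single j] <;> simp +contextual
  simp only [e1, e2, mul_one] at h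
  refine le_of_eq_of_le ?_ h
  simp only [sq, sum_sum_mul_sum]
  refine Finset.sum_congr rfl fun k _ => Finset.sum_congr rfl fun m _ => ?_
  rw [Finset.sum_mul]
  exact Finset.sum_congr rfl fun i _ => by ring

theorem sliceBound_of_real_bounds {K t R : ℝ} (hK : InjBound a K)
    (hS : ∀ (S : Fin n → Bool) (x : Fin n × Fin n → ℝ),
      ∑ p, ∑ q, decoupled a S p q * (x p * x q) ≤ t * ∑ p, x p ^ 2)
    (hR : 4 * t + K ≤ R ^ 2) : SliceBound a R := by
  intro E hE y hy
  let s : Fin n × Fin n → MvPolynomial (Fin n) ℝ := fun p => y p.1 * y p.2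
  have hs : ∀ p, (s p).totalDegree ≤ 2 := fun p => totalDegree_mul_le (hy _) (hy _)
  have hs2 : ∑ p, s p ^ 2 = (∑ i, y i ^ 2) ^ 2 := by
    rw [sq (∑ i, y i ^ 2), Finset.sum_mul_sum, Fintype.sum_prod_type]
    simp only [s, mul_pow]
  let u : Fin n → Fin n → MvPolynomial (Fin n) ℝ := fun i j =>
    ∑ k, MvPolynomial.C (a i j k) * (y j * y k)
  have hdiag : E (∑ i, ∑ j, u i j ^ 2) ≤ K * E ((∑ i, y i ^ 2) ^ 2) := by
    have h : ∀ j, E (∑ i, u i j ^ 2) ≤ K * E (∑ k, s (j, k) ^ 2) := by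
      intro j
      refine le_of_eq_of_le ?_ (hE.gram_le (hK.slice_le j) fun k => hs (j, k))
      congr 1
      simp only [u, s, sq, sum_sum_mul_sum, map_sum, map_mul]
      refine Finset.sum_congr rfl fun k _ => Finset.sum_congr rfl fun m _ => ?_
      rw [Finset.sum_mul]
      exact Finset.sum_congr rfl fun i _ => by ring
    rw [Finset.sum_comm, map_sum, ← hs2, Fintype.sum_prod_type, map_sum, Finset.mul_sum]
    exact Finset.sum_le_sum fun j _ => h j
  have hoff : ∀ S : Fin n → Bool,
      E (∑ i, ∑ j, ∑ l, if S j = true ∧ S l = false then u i j * u i l else 0) ≤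
        t * E ((∑ i, y i ^ 2) ^ 2) := by
    intro S
    rw [← hs2]
    refine le_of_eq_of_le ?_ (hE.gram_le (hS S) hs)
    congr 1
    rw [Fintype.sum_prod_type, Finset.sum_comm]
    refine Finset.sum_congr rfl fun j _ => ?_
    rw [Finset.sum_comm]
    refine Finset.sum_congr rfl fun l _ => ?_
    rw [Fintype.sum_prod_type]
    by_cases h : S j = true ∧ S l = false
    · simp only [decoupled, h, and_self, if_true, u, s, sum_sum_mul_sum, map_sum, map_mul]
      refine Finset.sum_congr rfl fun k _ => Finset.sum_congr rfl fun m _ => ?_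
      rw [Finset.sum_mul]
      exact Finset.sum_congr rfl fun i _ => by ring
    · simp [decoupled, h]
  have hsplit : MvPolynomial.C (2 ^ n) * ∑ i, sliceForm a y i ^ 2 =
      MvPolynomial.C (2 ^ n) * (∑ i, ∑ j, u i j ^ 2) + MvPolynomial.C 4 * ∑ S : Fin n → Bool,
        ∑ i, ∑ j, ∑ l, if S j = true ∧ S l = false then u i j * u i l else 0 := by
    rw [Finset.sum_comm (s := Finset.univ (α := Fin n → Bool)), Finset.mul_sum, Finset.mul_sum,
      Finset.mul_sum, ← Finset.sum_add_distrib]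
    refine Finset.sum_congr rfl fun i _ => ?_
    have := two_pow_mul_sum_sq (u i)
    rw [Fintype.card_fin] at this
    simp only [map_pow, map_ofNat]
    exact this
  have h := congrArg E hsplit
  rw [map_add, SpherePE.C_mul, SpherePE.C_mul, SpherePE.C_mul,
    map_sum E _ (Finset.univ (α := Fin n → Bool))] at h
  have hsum : ∑ S : Fin n → Bool,
      E (∑ i, ∑ j, ∑ l, if S j = true ∧ S l = false then u i j * u i l else 0) ≤
        2 ^ n * (t * E ((∑ i, y i ^ 2) ^ 2)) := by
    refine (Finset.sum_le_sum fun S _ => hoff S).trans_eq ?_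
    simp
  have hnn : 0 ≤ E ((∑ i, y i ^ 2) ^ 2) := by
    rw [← hs2]; exact hE.sum_sq_nonneg hs
  have h2 : (0 : ℝ) < 2 ^ n := by positivity
  refine (le_of_mul_le_mul_left ?_ h2).trans (mul_le_mul_of_nonneg_right hR hnn)
  rw [h]
  have := mul_le_mul_of_nonneg_left hdiag h2.le
  linarith

theorem SliceBound.average {κ : Type*} [Fintype κ] [Nonempty κ] {R : ℝ}
    {a : κ → Fin n → Fin n → Fin n → ℝ} (ha : ∀ π, SliceBound (a π) R) :
    SliceBound (fun i j k => (1 / (Fintype.card κ : ℝ)) * ∑ π, a π i j k) R := by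
  intro E hE y hy
  set N : ℝ := (Fintype.card κ : ℝ) with hN
  have hN0 : 0 < N := by rw [hN]; exact_mod_cast Fintype.card_pos
  have e : ∀ i, sliceForm (fun i j k => (1 / N) * ∑ π, a π i j k) y i =
      MvPolynomial.C (1 / N) * ∑ π, sliceForm (a π) y i := by
    intro i
    simp only [sliceForm, map_mul, map_sum, Finset.sum_mul, Finset.mul_sum]
    rw [Finset.sum_comm (s := Finset.univ (α := κ))]
    refine Finset.sum_congr rfl fun j _ => ?_
    rw [Finset.sum_comm (s := Finset.univ (α := κ))]
    exact Finset.sum_congr rfl fun k _ => Finset.sum_congr rfl fun π _ => by ring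
  have h1 : ∀ i, E ((∑ π, sliceForm (a π) y i) ^ 2) ≤ N * E (∑ π, sliceForm (a π) y i ^ 2) := by
    intro i
    have := hE.gram_le (κ := κ) (Z := fun _ _ => 1) (K := N)
      (fun x => by
        have := sq_sum_le_card_mul_sum_sq (s := Finset.univ) (f := x)
        simpa [sq, Finset.sum_mul_sum, hN] using this)
      (fun π => sliceForm_totalDegree (a := a π) hy i)
    simpa [sq, Finset.sum_mul_sum] using this
  have h2 : E (∑ i, ∑ π, sliceForm (a π) y i ^ 2) ≤ N * (R ^ 2 * E ((∑ i, y i ^ 2) ^ 2)) := by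
    rw [Finset.sum_comm, map_sum]
    refine (Finset.sum_le_sum fun π _ => ha π E hE y hy).trans_eq ?_
    simp [hN]
  simp only [e, mul_pow, ← map_pow]
  rw [← Finset.mul_sum, SpherePE.C_mul, map_sum]
  have h3 : ∑ i, E ((∑ π, sliceForm (a π) y i) ^ 2) ≤ N * (N * (R ^ 2 * E ((∑ i, y i ^ 2) ^ 2))) := by
    refine (Finset.sum_le_sum fun i _ => h1 i).trans ?_
    rw [← Finset.mul_sum, ← map_sum]
    exact mul_le_mul_of_nonneg_left h2 hN0.le
  refine (mul_le_mul_of_nonneg_left h3 (by positivity)).trans_eq ?_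
  field_simp

end

/-! ### Reduction of a tensor to its symmetrized and permuted slices -/

/-- A triple of indices as a multi-index. -/
def tripleEquiv (n : ℕ) : Fin n × Fin n × Fin n ≃ (Fin 3 → Fin n) where
  toFun p := ![p.1, p.2.1, p.2.2]
  invFun α := (α 0, α 1, α 2)
  left_inv _ := rfl
  right_inv α := by
    ext r
    fin_cases r <;> rfl

theorem tensorPoly_eq_triForm {n : ℕ} (T : Tensor n) :
    tensorPoly T = triForm (fun i j k => T ![i, j, k]) MvPolynomial.X MvPolynomial.X
      MvPolynomial.X := by
  rw [tensorPoly, ← (tripleEquiv n).sum_comp, Fintype.sum_prod_type, triForm]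
  refine Finset.sum_congr rfl fun i _ => ?_
  rw [Fintype.sum_prod_type]
  refine Finset.sum_congr rfl fun j _ => Finset.sum_congr rfl fun k _ => ?_
  change MvPolynomial.C (T ![i, j, k]) * ∏ r, MvPolynomial.X (![i, j, k] r) = _
  simp [Fin.prod_univ_three]

theorem tensorPoly_permTensor {n : ℕ} (π : Equiv.Perm (Fin 3)) (T : Tensor n) :
    tensorPoly (permTensor π T) = tensorPoly T := by
  unfold tensorPoly permTensor
  refine Fintype.sum_equiv (Equiv.arrowCongr π (Equiv.refl (Fin n))) _ _ fun α => ?_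
  change MvPolynomial.C (T fun r => α (π⁻¹ r)) * _ =
    MvPolynomial.C (T fun r => α (π⁻¹ r)) * ∏ r, MvPolynomial.X (α (π⁻¹ r))
  rw [Equiv.prod_comp π⁻¹ fun r => (MvPolynomial.X (α r) : MvPolynomial (Fin n) ℝ)]

theorem tensorPoly_symmetrize {n : ℕ} (T : Tensor n) :
    tensorPoly (symmetrize T) = tensorPoly T := by
  have h : tensorPoly (symmetrize T) = MvPolynomial.C (1 / (Fintype.card (Equiv.Perm (Fin 3)) : ℝ))
      * ∑ π : Equiv.Perm (Fin 3), tensorPoly (permTensor π T) := by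
    simp only [tensorPoly, symmetrize, Finset.mul_sum, map_mul, map_sum, Finset.sum_mul]
    rw [Finset.sum_comm]
    exact Finset.sum_congr rfl fun α _ => Finset.sum_congr rfl fun π _ => by ring
  rw [h]
  simp only [tensorPoly_permTensor, Finset.sum_const, Finset.card_univ, nsmul_eq_mul]
  rw [← mul_assoc, ← map_natCast MvPolynomial.C, ← map_mul, one_div,
    inv_mul_cancel₀ (by exact_mod_cast Fintype.card_ne_zero), MvPolynomial.C_1, one_mul]

theorem symmetrize_comp {n : ℕ} (T : Tensor n) (σ : Equiv.Perm (Fin 3)) (α : Fin 3 → Fin n) :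
    symmetrize T (fun r => α (σ r)) = symmetrize T α := by
  unfold symmetrize permTensor
  congr 1
  exact Fintype.sum_equiv (Equiv.mulRight σ⁻¹) _ _ fun π => by simp [mul_inv_rev]

/-- It suffices to bound the slices of each tensor obtained by permuting the indices. -/
theorem cubicBound_of_permTensor {n : ℕ} {T : Tensor n} {R : ℝ}
    (h : ∀ π : Equiv.Perm (Fin 3), SliceBound (fun i j k => permTensor π T ![i, j, k]) R) :
    CubicBound T R := by
  refine ⟨fun i j k => symmetrize T ![i, j, k], fun i j k => ?_, fun i j k => ?_,
    SliceBound.average h, ?_⟩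
  · beta_reduce
    rw [← symmetrize_comp T (Equiv.swap 0 1) ![i, j, k]]
    congr 1
    ext r
    fin_cases r <;> rfl
  · beta_reduce
    rw [← symmetrize_comp T (Equiv.swap 1 2) ![i, j, k]]
    congr 1
    ext r
    fin_cases r <;> rfl
  · rw [← tensorPoly_symmetrize, tensorPoly_eq_triForm]

theorem CubicBound.of_tensorPoly_eq {n : ℕ} {T T' : Tensor n} {R : ℝ} (h : CubicBound T R)
    (hT : tensorPoly T' = tensorPoly T) : CubicBound T' R := by
  obtain ⟨a, h₁, h₂, ha, haT⟩ := h
  exact ⟨a, h₁, h₂, ha, hT.trans haT⟩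

/-- The number of multi-indices whose nondecreasing rearrangement is `α`: the size of the orbit of
`α` under permutations if `α` is nondecreasing, and `0` otherwise. -/
def sortedMultiplicity {n : ℕ} (α : Fin 3 → Fin n) : ℕ :=
  (Finset.univ.filter fun β : Fin 3 → Fin n => β ∘ Tuple.sort β = α).card

theorem sortedMultiplicity_le {n : ℕ} (α : Fin 3 → Fin n) : sortedMultiplicity α ≤ 6 := by
  have h : (Finset.univ.filter fun β : Fin 3 → Fin n => β ∘ Tuple.sort β = α) ⊆
      Finset.univ.image fun σ : Equiv.Perm (Fin 3) => α ∘ σ := by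
    intro β hβ
    rw [Finset.mem_filter] at hβ
    rw [Finset.mem_image]
    refine ⟨(Tuple.sort β)⁻¹, Finset.mem_univ _, ?_⟩
    rw [← hβ.2]
    ext r
    simp
  refine (Finset.card_le_card h).trans (Finset.card_image_le.trans ?_)
  rw [Finset.card_univ, Fintype.card_perm, Fintype.card_fin]
  decide

theorem sortedMultiplicity_eq_zero {n : ℕ} {α : Fin 3 → Fin n} (h : ¬ Monotone α) :
    sortedMultiplicity α = 0 := by
  rw [sortedMultiplicity, Finset.card_eq_zero, Finset.filter_eq_empty_iff]
  rintro β - rfl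
  exact h (Tuple.monotone_sort β)

/-- A symmetric tensor has the same cubic form as the tensor supported on nondecreasing
multi-indices, weighted with orbit sizes. -/
theorem tensorPoly_eq_of_symm {n : ℕ} {T : Tensor n}
    (hT : ∀ π : Equiv.Perm (Fin 3), permTensor π T = T) :
    tensorPoly T = tensorPoly fun α => (sortedMultiplicity α : ℝ) * T α := by
  let F : (Fin 3 → Fin n) → MvPolynomial (Fin n) ℝ := fun α =>
    MvPolynomial.C (T α) * ∏ r, MvPolynomial.X (α r)
  have hF : ∀ β, F β = F (β ∘ Tuple.sort β) := by
    intro β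
    simp only [F]
    congr 1
    · congr 1
      conv_lhs => rw [← hT (Tuple.sort β)⁻¹]
      simp [permTensor, Function.comp_def]
    · exact (Equiv.prod_comp (Tuple.sort β) fun r =>
        (MvPolynomial.X (β r) : MvPolynomial (Fin n) ℝ)).symm
  change ∑ β, F β = _
  rw [Finset.sum_congr rfl fun β _ => hF β,
    ← Finset.sum_fiberwise (g := fun β : Fin 3 → Fin n => β ∘ Tuple.sort β)]
  refine Finset.sum_congr rfl fun α _ => ?_
  rw [Finset.sum_congr rfl fun β hβ => congrArg F (Finset.mem_filter.mp hβ).2, Finset.sum_const,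
    nsmul_eq_mul]
  simp only [F, sortedMultiplicity, map_mul, map_natCast]
  ring

/-! ### Nets of the Euclidean ball -/

/-- The ball of radius `2` has a `1`-net of at most `5 ^ d` points, and the maximum of a linear form
over it dominates the norm of the form. -/
theorem exists_net (ι : Type*) [Fintype ι] : ∃ N : Finset (ι → ℝ),
    N.card ≤ 5 ^ Fintype.card ι ∧ (∀ x ∈ N, ∑ i, x i ^ 2 ≤ 4) ∧
      ∀ (c : ι → ℝ) (K : ℝ), (∀ x ∈ N, ∑ i, c i * x i ≤ K) → ∑ i, c i ^ 2 ≤ K ^ 2 := by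
  classical
  let sep : Finset (EuclideanSpace ℝ ι) → Prop := fun s =>
    (∀ x ∈ s, ‖x‖ ≤ 2) ∧ ∀ x ∈ s, ∀ y ∈ s, x ≠ y → 1 ≤ ‖x - y‖
  have hcard : ∀ s, sep s → s.card ≤ 5 ^ Fintype.card ι := by
    intro s hs
    have := Besicovitch.card_le_of_separated s hs.1 hs.2
    rwa [finrank_euclideanSpace] at this
  -- a separated set of maximal cardinality
  obtain ⟨s, hs, hmax⟩ : ∃ s, sep s ∧ ∀ s', sep s' → s'.card ≤ s.card := by
    let P : ℕ → Prop := fun k => ∃ s, sep s ∧ s.card = k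
    have h0 : P 0 := ⟨∅, ⟨by simp, by simp⟩, rfl⟩
    obtain ⟨s, hs, hk⟩ := Nat.findGreatest_spec (P := P) (Nat.zero_le (5 ^ Fintype.card ι)) h0
    refine ⟨s, hs, fun s' hs' => ?_⟩
    rw [hk]
    exact Nat.le_findGreatest (hcard s' hs') ⟨s', hs', rfl⟩
  have hnet : ∀ u : EuclideanSpace ℝ ι, ‖u‖ ≤ 2 → ∃ x ∈ s, ‖u - x‖ ≤ 1 := by
    intro u hu
    by_contra! h
    have hus : u ∉ s := fun hmem => by
      have := h u hmem
      simp at this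
      linarith
    have hsep : sep (insert u s) := by
      refine ⟨fun x hx => ?_, fun x hx y hy hxy => ?_⟩
      · rcases Finset.mem_insert.mp hx with rfl | hx
        · exact hu
        · exact hs.1 x hx
      · rcases Finset.mem_insert.mp hx with rfl | hx <;> rcases Finset.mem_insert.mp hy with rfl | hy
        · exact absurd rfl hxy
        · exact (h y hy).le
        · rw [norm_sub_rev]
          exact (h _ ‹_›).le
        · exact hs.2 x ‹_› y ‹_› hxy
    have := hmax _ hsep
    rw [Finset.card_insert_of_notMem hus] at this
    omega
  refine ⟨s.image fun x => x.ofLp, Finset.card_image_le.trans (hcard s hs), ?_, ?_⟩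
  · intro x hx
    obtain ⟨y, hy, rfl⟩ := Finset.mem_image.mp hx
    rw [← EuclideanSpace.real_norm_sq_eq]
    have := pow_le_pow_left₀ (norm_nonneg y) (hs.1 y hy) 2
    linarith
  · intro c K h
    let c' : EuclideanSpace ℝ ι := WithLp.toLp 2 c
    have hc' : ∑ i, c i ^ 2 = ‖c'‖ ^ 2 := (EuclideanSpace.real_norm_sq_eq c').symm
    rw [hc']
    rcases eq_or_ne c' 0 with h0 | h0
    · rw [h0]
      simpa using sq_nonneg K
    have hpos : 0 < ‖c'‖ := norm_pos_iff.mpr h0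
    have hu : ‖(2 * ‖c'‖⁻¹) • c'‖ = 2 := by
      rw [norm_smul, Real.norm_of_nonneg (by positivity), mul_assoc, inv_mul_cancel₀ hpos.ne',
        mul_one]
    obtain ⟨x, hx, hux⟩ := hnet _ hu.le
    have hK := h x.ofLp (Finset.mem_image_of_mem _ hx)
    have hin : ∑ i, c i * x.ofLp i = inner ℝ c' x := by
      simp [c', PiLp.inner_apply, mul_comm]
    rw [hin] at hK
    have h1 : inner ℝ c' ((2 * ‖c'‖⁻¹) • c' - x) ≤ ‖c'‖ :=
      (real_inner_le_norm _ _).trans (mul_le_of_le_one_right hpos.le hux)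
    have h2 : inner ℝ c' ((2 * ‖c'‖⁻¹) • c') = 2 * ‖c'‖ := by
      rw [real_inner_smul_right, real_inner_self_eq_norm_sq]
      field_simp
    rw [inner_sub_right, h2] at h1
    exact pow_le_pow_left₀ hpos.le (by linarith) 2

theorem dot_le_of_sum_sq_le {ι : Type*} [Fintype ι] {c x : ι → ℝ} {K : ℝ} (hK : 0 ≤ K)
    (hc : ∑ i, c i ^ 2 ≤ K ^ 2) : ∑ i, c i * x i ≤ K * √(∑ i, x i ^ 2) := by
  have hx : 0 ≤ ∑ i, x i ^ 2 := Finset.sum_nonneg fun i _ => sq_nonneg _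
  refine le_of_sq_le_sq ?_ (by positivity)
  rw [mul_pow, Real.sq_sqrt hx]
  exact (Finset.sum_mul_sq_le_sq_mul_sq _ _ _).trans (mul_le_mul_of_nonneg_right hc hx)

/-- A bilinear form bounded on a net is bounded as a quadratic form. -/
theorem quadForm_le_of_net {κ : Type*} [Fintype κ] {N : Finset (κ → ℝ)}
    (hN : ∀ (c : κ → ℝ) (K : ℝ), (∀ x ∈ N, ∑ i, c i * x i ≤ K) → ∑ i, c i ^ 2 ≤ K ^ 2)
    {Z : κ → κ → ℝ} {t : ℝ} (ht : 0 ≤ t)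
    (h : ∀ x ∈ N, ∀ y ∈ N, ∑ p, ∑ q, Z p q * (x p * y q) ≤ t) (x : κ → ℝ) :
    ∑ p, ∑ q, Z p q * (x p * x q) ≤ t * ∑ p, x p ^ 2 := by
  have e1 : ∀ x y : κ → ℝ, ∑ p, ∑ q, Z p q * (x p * y q) = ∑ p, (∑ q, Z p q * y q) * x p := by
    intro x y
    refine Finset.sum_congr rfl fun p _ => ?_
    rw [Finset.sum_mul]
    exact Finset.sum_congr rfl fun q _ => by ring
  have e2 : ∀ x y : κ → ℝ, ∑ p, ∑ q, Z p q * (x p * y q) = ∑ q, (∑ p, Z p q * x p) * y q := by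
    intro x y
    rw [Finset.sum_comm]
    refine Finset.sum_congr rfl fun q _ => ?_
    rw [Finset.sum_mul]
    exact Finset.sum_congr rfl fun p _ => by ring
  have hx : 0 ≤ ∑ i, x i ^ 2 := Finset.sum_nonneg fun i _ => sq_nonneg _
  have h1 : ∀ y ∈ N, ∑ p, ∑ q, Z p q * (x p * y q) ≤ t * √(∑ p, x p ^ 2) := by
    intro y hy
    rw [e1]
    exact dot_le_of_sum_sq_le ht (hN _ t fun z hz => by rw [← e1]; exact h z hz y hy)
  rw [e2]
  refine (dot_le_of_sum_sq_le (by positivity) (hN _ (t * √(∑ p, x p ^ 2)) fun y hy => ?_)).trans_eq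
    ?_
  · rw [← e2]
    exact h1 y hy
  · rw [mul_assoc, Real.mul_self_sqrt hx]

/-- A trilinear form bounded on a net satisfies `InjBound`. -/
theorem injBound_of_net {ι : Type*} [Fintype ι] {N : Finset (ι → ℝ)}
    (hN : ∀ (c : ι → ℝ) (K : ℝ), (∀ x ∈ N, ∑ i, c i * x i ≤ K) → ∑ i, c i ^ 2 ≤ K ^ 2)
    {a : ι → ι → ι → ℝ} {s : ℝ} (hs : 0 ≤ s)
    (h : ∀ x ∈ N, ∀ y ∈ N, ∀ z ∈ N, ∑ i, ∑ j, ∑ k, a i j k * (x i * y j * z k) ≤ s) :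
    InjBound a (s ^ 2) := by
  have e1 : ∀ x y z : ι → ℝ, ∑ i, ∑ j, ∑ k, a i j k * (x i * y j * z k) =
      ∑ i, (∑ j, ∑ k, a i j k * (y j * z k)) * x i := by
    intro x y z
    simp only [Finset.sum_mul]
    exact Finset.sum_congr rfl fun i _ => Finset.sum_congr rfl fun j _ =>
      Finset.sum_congr rfl fun k _ => by ring
  have e2 : ∀ x y z : ι → ℝ, ∑ i, ∑ j, ∑ k, a i j k * (x i * y j * z k) =
      ∑ j, (∑ i, ∑ k, a i j k * (x i * z k)) * y j := by
    intro x y z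
    simp only [Finset.sum_mul]
    rw [Finset.sum_comm]
    exact Finset.sum_congr rfl fun i _ => Finset.sum_congr rfl fun j _ =>
      Finset.sum_congr rfl fun k _ => by ring
  have e3 : ∀ x y z : ι → ℝ, ∑ i, ∑ j, ∑ k, a i j k * (x i * y j * z k) =
      ∑ k, (∑ i, ∑ j, a i j k * (x i * y j)) * z k := by
    intro x y z
    simp only [Finset.sum_mul]
    rw [Finset.sum_congr rfl fun i _ => Finset.sum_comm, Finset.sum_comm]
    exact Finset.sum_congr rfl fun i _ => Finset.sum_congr rfl fun j _ =>
      Finset.sum_congr rfl fun k _ => by ring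
  have h1 : ∀ x : ι → ℝ, ∀ y ∈ N, ∀ z ∈ N,
      ∑ i, ∑ j, ∑ k, a i j k * (x i * y j * z k) ≤ s * √(∑ i, x i ^ 2) := by
    intro x y hy z hz
    rw [e1]
    exact dot_le_of_sum_sq_le hs (hN _ s fun x hx => by rw [← e1]; exact h x hx y hy z hz)
  have h2 : ∀ x y : ι → ℝ, ∀ z ∈ N,
      ∑ i, ∑ j, ∑ k, a i j k * (x i * y j * z k) ≤
        s * √(∑ i, x i ^ 2) * √(∑ i, y i ^ 2) := by
    intro x y z hz
    rw [e2]
    exact dot_le_of_sum_sq_le (by positivity) (hN _ _ fun y hy => by rw [← e2]; exact h1 x y hy z hz)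
  have h3 : ∀ x y z : ι → ℝ,
      ∑ i, ∑ j, ∑ k, a i j k * (x i * y j * z k) ≤
        s * √(∑ i, x i ^ 2) * √(∑ i, y i ^ 2) * √(∑ i, z i ^ 2) := by
    intro x y z
    rw [e3]
    exact dot_le_of_sum_sq_le (by positivity) (hN _ _ fun z hz => by rw [← e3]; exact h2 x y z hz)
  intro b c
  have hb : 0 ≤ ∑ i, b i ^ 2 := Finset.sum_nonneg fun i _ => sq_nonneg _
  have hc : 0 ≤ ∑ i, c i ^ 2 := Finset.sum_nonneg fun i _ => sq_nonneg _
  have key := h3 (fun i => ∑ j, ∑ k, a i j k * (b j * c k)) b c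
  rw [e1] at key
  simp only [← sq] at key
  set Q := ∑ i, (∑ j, ∑ k, a i j k * (b j * c k)) ^ 2 with hQ
  have hQ0 : 0 ≤ Q := Finset.sum_nonneg fun i _ => sq_nonneg _
  set β := √(∑ i, b i ^ 2) with hβ
  set γ := √(∑ i, c i ^ 2) with hγ
  rw [← Real.sq_sqrt hb, ← Real.sq_sqrt hc, ← hβ, ← hγ]
  -- `Q ≤ s β γ √Q` gives `√Q ≤ s β γ`
  have hqs := Real.sq_sqrt hQ0
  have hq0 := Real.sqrt_nonneg Q
  set q := √Q
  have hq : q ≤ s * β * γ := by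
    by_contra! hlt
    have hqpos : 0 < q := lt_of_le_of_lt (by positivity) hlt
    nlinarith
  calc Q = q ^ 2 := hqs.symm
    _ ≤ (s * β * γ) ^ 2 := pow_le_pow_left₀ hq0 hq 2
    _ = _ := by ring

theorem InjBound.sum_sq_le {ι : Type*} [Fintype ι] {a : ι → ι → ι → ℝ} {K : ℝ} (ha : InjBound a K)
    (x y : ι × ι → ℝ) :
    ∑ i, ∑ j, ∑ k, (∑ l, ∑ m, a i l m * (x (j, l) * y (k, m))) ^ 2 ≤
      K * (∑ p, x p ^ 2) * ∑ p, y p ^ 2 := by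
  rw [Finset.sum_comm, Finset.sum_congr rfl fun j _ => Finset.sum_comm]
  have h : ∀ j k, ∑ i, (∑ l, ∑ m, a i l m * (x (j, l) * y (k, m))) ^ 2 ≤
      K * (∑ l, x (j, l) ^ 2) * ∑ m, y (k, m) ^ 2 := fun j k =>
    ha (fun l => x (j, l)) fun m => y (k, m)
  refine (Finset.sum_le_sum fun j _ => Finset.sum_le_sum fun k _ => h j k).trans_eq ?_
  simp only [Fintype.sum_prod_type, mul_assoc, ← Finset.mul_sum, ← Finset.sum_mul]

theorem InjBound.restrict {ι : Type*} [Fintype ι] {a : ι → ι → ι → ℝ} {K : ℝ} (hK : 0 ≤ K)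
    (ha : InjBound a K) (S : ι → Bool) :
    InjBound (fun i j k => if S j = true then 0 else a i j k) K := by
  intro b c
  have h := ha (fun j => if S j = true then 0 else b j) c
  have e : ∀ i, ∑ j, ∑ k, (if S j = true then 0 else a i j k) * (b j * c k) =
      ∑ j, ∑ k, a i j k * ((if S j = true then 0 else b j) * c k) := fun i =>
    Finset.sum_congr rfl fun j _ => Finset.sum_congr rfl fun k _ => by split_ifs <;> simp
  simp only [e]
  refine h.trans ?_
  have hc : 0 ≤ ∑ i, c i ^ 2 := Finset.sum_nonneg fun i _ => sq_nonneg _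
  refine mul_le_mul_of_nonneg_right (mul_le_mul_of_nonneg_left ?_ hK) hc
  refine Finset.sum_le_sum fun j _ => ?_
  split_ifs
  · simpa using sq_nonneg (b j)
  · exact le_rfl

theorem sum_decoupled {ι : Type*} [Fintype ι] (a : ι → ι → ι → ℝ) (S : ι → Bool)
    (x y : ι × ι → ℝ) :
    ∑ p, ∑ q, decoupled a S p q * (x p * y q) =
      ∑ i, ∑ j, ∑ k, (if S j = true then a i j k else 0) *
        ∑ l, ∑ m, (if S l = true then 0 else a i l m) * (x (j, l) * y (k, m)) := by
  have e : ∀ j l k m, decoupled a S (j, l) (k, m) * (x (j, l) * y (k, m)) =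
      ∑ i, (if S j = true then a i j k else 0) *
        ((if S l = true then 0 else a i l m) * (x (j, l) * y (k, m))) := by
    intro j l k m
    unfold decoupled
    by_cases h1 : S j = true <;> by_cases h2 : S l = true
    · simp [h1, h2]
    · rw [if_pos ⟨h1, Bool.eq_false_iff.mpr h2⟩, Finset.sum_mul]
      exact Finset.sum_congr rfl fun i _ => by rw [if_pos h1, if_neg h2]; ring
    · simp [h1]
    · simp [h1]
  simp only [Fintype.sum_prod_type, e, Finset.mul_sum]
  conv_rhs => rw [Finset.sum_comm]
  refine Finset.sum_congr rfl fun j _ => ?_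
  rw [Finset.sum_comm]
  conv_rhs => rw [Finset.sum_comm]
  refine Finset.sum_congr rfl fun k _ => ?_
  conv_rhs => rw [Finset.sum_comm]
  exact Finset.sum_congr rfl fun l _ => Finset.sum_comm

/-! ### Concentration of multilinear forms in independent sub-Gaussian variables -/

section

variable {Ω : Type*} [MeasurableSpace Ω] {μ : Measure Ω}

theorem HasSubgaussianMGF.mono {X : Ω → ℝ} {c c' : ℝ≥0} (h : HasSubgaussianMGF X c μ)
    (hc : c ≤ c') : HasSubgaussianMGF X c' μ where
  integrable_exp_mul := h.integrable_exp_mul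
  mgf_le t := (h.mgf_le t).trans (by gcongr)

/-- The Chernoff bound for a linear combination of independent sub-Gaussian variables, in terms of an
upper bound `V` on the sum of the squared coefficients. -/
theorem measure_le_sum_mul_le {κ : Type*} [Fintype κ] {X : κ → Ω → ℝ} {c V : ℝ≥0}
    (hX : iIndepFun X μ) (hc : ∀ α, HasSubgaussianMGF (X α) c μ) {w : κ → ℝ}
    (hw : ∑ α, w α ^ 2 ≤ V) {s : ℝ} (hs : 0 ≤ s) :
    μ {ω | s ≤ ∑ α, w α * X α ω} ≤ ENNReal.ofReal (Real.exp (-s ^ 2 / (2 * (V * c)))) := by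
  have : IsProbabilityMeasure μ := hX.isProbabilityMeasure
  have hind : iIndepFun (fun α ω => w α * X α ω) μ :=
    hX.comp (fun α x => w α * x) fun α => measurable_const_mul _
  have hsum := HasSubgaussianMGF.sum_of_iIndepFun hind (s := Finset.univ)
    fun α _ => (hc α).const_mul (w α)
  have hle : ∑ α, NNReal.mk (w α ^ 2) (sq_nonneg (w α)) * c ≤ V * c := by
    rw [← Finset.sum_mul]
    gcongr
    rw [← NNReal.coe_le_coe, NNReal.coe_sum]
    exact hw
  have h := (HasSubgaussianMGF.mono hsum hle).measure_ge_le hs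
  rw [NNReal.coe_mul] at h
  rw [← ENNReal.ofReal_toReal (measure_ne_top μ _)]
  exact ENNReal.ofReal_le_ofReal h

/-- To bound the probability of an event about two independent variables, it suffices to bound it
for each fixed value of the second one. -/
theorem IndepFun.measure_le_of_forall_section {β γ : Type*} [MeasurableSpace β] [MeasurableSpace γ]
    [IsProbabilityMeasure μ] {U : Ω → β} {V : Ω → γ} (h : IndepFun U V μ) (hU : AEMeasurable U μ)
    (hV : AEMeasurable V μ) {B : Set (β × γ)} (hB : MeasurableSet B) {q : ℝ≥0∞}
    (hq : ∀ v, μ {ω | (U ω, v) ∈ B} ≤ q) : μ {ω | (U ω, V ω) ∈ B} ≤ q := by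
  have hUp := Measure.isProbabilityMeasure_map hU
  have hVp := Measure.isProbabilityMeasure_map hV
  calc μ {ω | (U ω, V ω) ∈ B} = μ.map (fun ω => (U ω, V ω)) B :=
        (Measure.map_apply_of_aemeasurable (hU.prodMk hV) hB).symm
    _ = ∫⁻ v, μ.map U ((fun u => (u, v)) ⁻¹' B) ∂(μ.map V) := by
        rw [(indepFun_iff_map_prod_eq_prod_map_map hU hV).mp h, Measure.prod_apply_symm hB]
    _ ≤ ∫⁻ _, q ∂(μ.map V) := by
        refine lintegral_mono fun v => ?_
        rw [Measure.map_apply_of_aemeasurable hU (measurable_prodMk_right hB)]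
        exact hq v
    _ = q := by simp

/-- The restrictions of an independent family to a set of indices and to its complement, both
extended by zero, are independent. -/
theorem iIndepFun.indepFun_restrict {κ : Type*} [Fintype κ] {X : κ → Ω → ℝ} (hX : iIndepFun X μ)
    (hm : ∀ α, AEMeasurable (X α) μ) (D : κ → Prop) [DecidablePred D] :
    IndepFun (fun ω α => if D α then X α ω else 0) (fun ω α => if D α then 0 else X α ω) μ := by
  classical
  have h := hX.indepFun_finset₀ (Finset.univ.filter D) (Finset.univ.filter fun α => ¬ D α)
    (Finset.disjoint_filter_filter_not _ _ _) hm
  let φ : (Finset.univ.filter D → ℝ) → κ → ℝ := fun u α =>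
    if h : α ∈ Finset.univ.filter D then u ⟨α, h⟩ else 0
  let ψ : ((Finset.univ.filter fun α => ¬ D α) → ℝ) → κ → ℝ := fun u α =>
    if h : α ∈ Finset.univ.filter fun α => ¬ D α then u ⟨α, h⟩ else 0
  have hφ : Measurable φ := by
    refine measurable_pi_lambda _ fun α => ?_
    by_cases hα : α ∈ Finset.univ.filter D
    · simp only [φ, dif_pos hα]; exact measurable_pi_apply _
    · simp only [φ, dif_neg hα]; exact measurable_const
  have hψ : Measurable ψ := by
    refine measurable_pi_lambda _ fun α => ?_
    by_cases hα : α ∈ Finset.univ.filter fun α => ¬ D α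
    · simp only [ψ, dif_pos hα]; exact measurable_pi_apply _
    · simp only [ψ, dif_neg hα]; exact measurable_const
  convert! h.comp hφ hψ using 1
  · ext ω α
    by_cases hα : D α <;> simp [φ, hα]
  · ext ω α
    by_cases hα : D α <;> simp [ψ, hα]

theorem measure_biUnion_finset_le_card_mul {β : Type*} (s : Finset β) (f : β → Set Ω) {q : ℝ≥0∞}
    (h : ∀ b ∈ s, μ (f b) ≤ q) : μ (⋃ b ∈ s, f b) ≤ s.card * q := by
  refine (measure_biUnion_finset_le s f).trans ?_
  rw [← nsmul_eq_mul]
  exact Finset.sum_le_card_nsmul _ _ _ h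

end

section

variable {Ω : Type*} [MeasurableSpace Ω] {μ : Measure Ω} {ι : Type*} [Fintype ι]
  {X : ι × ι × ι → Ω → ℝ} {c : ℝ≥0}

theorem measure_not_injBound_le (hX : iIndepFun X μ) (hc : ∀ α, HasSubgaussianMGF (X α) c μ)
    {s : ℝ} (hs : 0 ≤ s) :
    μ {ω | ¬ InjBound (fun i j k => X (i, j, k) ω) (s ^ 2)} ≤
      ENNReal.ofReal (125 ^ Fintype.card ι * Real.exp (-s ^ 2 / (128 * c))) := by
  obtain ⟨N, hcard, hN4, hN⟩ := exists_net ι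
  have hsub : {ω | ¬ InjBound (fun i j k => X (i, j, k) ω) (s ^ 2)} ⊆
      ⋃ p ∈ N ×ˢ N ×ˢ N, {ω | s ≤ ∑ α : ι × ι × ι,
        (p.1 α.1 * p.2.1 α.2.1 * p.2.2 α.2.2) * X α ω} := by
    intro ω hω
    by_contra hcon
    refine hω (injBound_of_net hN hs fun x hx y hy z hz => ?_)
    simp only [Set.mem_iUnion, not_exists] at hcon
    have := hcon (x, y, z) (by simp [hx, hy, hz])
    simp only [Set.mem_ofPred_eq, not_le, Fintype.sum_prod_type] at this
    refine (le_of_eq ?_).trans this.le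
    exact Finset.sum_congr rfl fun i _ => Finset.sum_congr rfl fun j _ =>
      Finset.sum_congr rfl fun k _ => mul_comm _ _
  refine (measure_mono hsub).trans ((measure_biUnion_finset_le_card_mul _ _
    (q := ENNReal.ofReal (Real.exp (-s ^ 2 / (128 * c)))) fun p hp => ?_).trans ?_)
  · simp only [Finset.mem_product] at hp
    have hw : ∑ α : ι × ι × ι, (p.1 α.1 * p.2.1 α.2.1 * p.2.2 α.2.2) ^ 2 ≤ (64 : ℝ≥0) := by
      simp only [Fintype.sum_prod_type, mul_pow, ← Finset.mul_sum, ← Finset.sum_mul]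
      have h1 := hN4 _ hp.1
      have h2 := hN4 _ hp.2.1
      have h3 := hN4 _ hp.2.2
      have n1 : 0 ≤ ∑ i, p.1 i ^ 2 := Finset.sum_nonneg fun i _ => sq_nonneg _
      have n2 : 0 ≤ ∑ i, p.2.1 i ^ 2 := Finset.sum_nonneg fun i _ => sq_nonneg _
      have n3 : 0 ≤ ∑ i, p.2.2 i ^ 2 := Finset.sum_nonneg fun i _ => sq_nonneg _
      calc _ ≤ (4 : ℝ) * 4 * 4 := by gcongr
        _ = _ := by norm_num
    have := measure_le_sum_mul_le hX hc hw hs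
    convert! this using 4
    push_cast
    ring
  · rw [← ENNReal.ofReal_natCast, ← ENNReal.ofReal_mul (by positivity)]
    refine ENNReal.ofReal_le_ofReal (mul_le_mul_of_nonneg_right ?_ (Real.exp_pos _).le)
    rw [Finset.card_product, Finset.card_product]
    have h5 : (N.card : ℝ) ≤ 5 ^ Fintype.card ι := by exact_mod_cast hcard
    push_cast
    calc (N.card : ℝ) * (N.card * N.card) ≤ 5 ^ Fintype.card ι * (5 ^ Fintype.card ι *
          5 ^ Fintype.card ι) := by gcongr
      _ = 125 ^ Fintype.card ι := by
        rw [← mul_pow, ← mul_pow]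
        norm_num

theorem isClosed_setOf_injBound (K : ℝ) :
    IsClosed {v : ι × ι × ι → ℝ | InjBound (fun i j k => v (i, j, k)) K} := by
  simp only [InjBound, Set.ofPred_forall]
  refine isClosed_iInter fun b => isClosed_iInter fun d => isClosed_le ?_ continuous_const
  fun_prop

/-- Conditionally on the entries in the rows outside `S`, the decoupled form is linear in the
remaining entries, and `InjBound` controls its variance. -/
theorem measure_decoupled_le (hX : iIndepFun X μ) (hc : ∀ α, HasSubgaussianMGF (X α) c μ)
    (S : ι → Bool) {x y : ι × ι → ℝ} (hx : ∑ p, x p ^ 2 ≤ 4) (hy : ∑ p, y p ^ 2 ≤ 4) (K : ℝ≥0)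
    {t : ℝ} (ht : 0 ≤ t) :
    μ {ω | InjBound (fun i j k => X (i, j, k) ω) K ∧
        t ≤ ∑ p, ∑ q, decoupled (fun i j k => X (i, j, k) ω) S p q * (x p * y q)} ≤
      ENNReal.ofReal (Real.exp (-t ^ 2 / (32 * (K * c)))) := by
  have : IsProbabilityMeasure μ := hX.isProbabilityMeasure
  have hm : ∀ α, AEMeasurable (X α) μ := fun α => (hc α).aemeasurable
  let D : ι × ι × ι → Prop := fun α => S α.2.1 = true
  let w : (ι × ι × ι → ℝ) → ι × ι × ι → ℝ := fun v α =>
    ∑ l, ∑ m, v (α.1, l, m) * (x (α.2.1, l) * y (α.2.2, m))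
  have hind := iIndepFun.indepFun_restrict hX hm D
  let B : Set ((ι × ι × ι → ℝ) × (ι × ι × ι → ℝ)) :=
    {p | InjBound (fun i j k => p.2 (i, j, k)) K ∧ t ≤ ∑ α, p.1 α * w p.2 α}
  have hB : MeasurableSet B := by
    have h1 : IsClosed {p : (ι × ι × ι → ℝ) × (ι × ι × ι → ℝ) |
        InjBound (fun i j k => p.2 (i, j, k)) K} :=
      (isClosed_setOf_injBound (K : ℝ)).preimage continuous_snd
    have h2 : IsClosed {p : (ι × ι × ι → ℝ) × (ι × ι × ι → ℝ) | t ≤ ∑ α, p.1 α * w p.2 α} :=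
      isClosed_le continuous_const (by simp only [w]; fun_prop)
    exact (h1.inter h2).measurableSet
  have hU : AEMeasurable (fun ω α => if D α then X α ω else 0) μ :=
    aemeasurable_pi_lambda _ fun α => by split_ifs; exacts [hm α, aemeasurable_const]
  have hV : AEMeasurable (fun ω α => if D α then 0 else X α ω) μ :=
    aemeasurable_pi_lambda _ fun α => by split_ifs; exacts [aemeasurable_const, hm α]
  refine (measure_mono fun ω hω => ?_).trans (IndepFun.measure_le_of_forall_section hind hU hV hB
    (q := ENNReal.ofReal (Real.exp (-t ^ 2 / (32 * (K * c))))) fun v => ?_)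
  · refine ⟨hω.1.restrict K.2 S, hω.2.trans_eq ?_⟩
    rw [sum_decoupled]
    simp only [Fintype.sum_prod_type, D, w]
  · by_cases hv : InjBound (fun i j k => v (i, j, k)) K
    · have hw : ∑ α, (if D α then w v α else 0) ^ 2 ≤ ((K * 16 : ℝ≥0) : ℝ) := by
        have h1 : ∑ α, (if D α then w v α else 0) ^ 2 ≤ ∑ α, w v α ^ 2 :=
          Finset.sum_le_sum fun α _ => by
            split_ifs
            · exact le_rfl
            · simpa using sq_nonneg (w v α)
        have h2 := hv.sum_sq_le x y
        have n1 : 0 ≤ ∑ p, x p ^ 2 := Finset.sum_nonneg fun i _ => sq_nonneg _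
        have n2 : 0 ≤ ∑ p, y p ^ 2 := Finset.sum_nonneg fun i _ => sq_nonneg _
        calc _ ≤ ∑ α, w v α ^ 2 := h1
          _ ≤ K * (∑ p, x p ^ 2) * ∑ p, y p ^ 2 := by
            simpa only [Fintype.sum_prod_type, w] using h2
          _ ≤ K * 4 * 4 := by gcongr
          _ = _ := by push_cast; ring
      refine (measure_mono fun ω hω => ?_).trans ((measure_le_sum_mul_le hX hc hw ht).trans_eq ?_)
      · refine hω.2.trans_eq (Finset.sum_congr rfl fun α _ => ?_)
        by_cases hα : D α <;> simp [hα, mul_comm]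
      · congr 3
        push_cast
        ring
    · have : {ω | ((fun α => if D α then X α ω else 0), v) ∈ B} = ∅ := by
        ext ω
        simp [B, hv]
      rw [this, measure_empty]
      exact bot_le

end

/-! ### Noise with independent sub-Gaussian entries -/

theorem rpow_three_quarters_sq (n : ℕ) : ((n : ℝ) ^ (3 / 4 : ℝ)) ^ 2 = n * √n := by
  rw [← Real.rpow_natCast, ← Real.rpow_mul (Nat.cast_nonneg n), Real.sqrt_eq_rpow]
  rcases Nat.eq_zero_or_pos n with rfl | hn
  · norm_num
  · rw [← Real.rpow_one_add' (Nat.cast_nonneg n) (by norm_num)]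
    norm_num

section

variable {Ω : Type*} [MeasurableSpace Ω] {μ : Measure Ω} {n : ℕ} {c : ℝ≥0}

/-- The constants are chosen such that each form on the nets exceeds its threshold with probability
at most `exp (-6 n)`, respectively `exp (-6 n²)`, which beats the cardinalities `125 ^ n` and
`2 ^ n * 25 ^ n²` of the nets. -/
theorem measure_not_sliceBound_le {X : Fin n × Fin n × Fin n → Ω → ℝ} (hn : 1 ≤ n) (hc0 : 0 < c)
    (hX : iIndepFun X μ) (hc : ∀ α, HasSubgaussianMGF (X α) c μ) :
    μ {ω | ¬ SliceBound (fun i j k => X (i, j, k) ω) (48 * √c * (n : ℝ) ^ (3 / 4 : ℝ))} ≤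
      ENNReal.ofReal (2 * Real.exp (-n)) := by
  have hn' : (1 : ℝ) ≤ n := by exact_mod_cast hn
  have hc' : (0 : ℝ) < c := by exact_mod_cast hc0
  have hexp : 2.7 < Real.exp 1 := lt_trans (by norm_num) Real.exp_one_gt_d9
  set s : ℝ := √(768 * c * n) with hs
  have hs2 : s ^ 2 = 768 * c * n := Real.sq_sqrt (by positivity)
  set t : ℝ := 384 * c * (n * √n) with ht
  have ht0 : 0 ≤ t := by positivity
  let K : ℝ≥0 := 768 * c * n
  have hK : (K : ℝ) = s ^ 2 := by rw [hs2]; push_cast [K]; rfl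
  obtain ⟨N, hcard, hN4, hN⟩ := exists_net (Fin n × Fin n)
  let F : (Fin n → Bool) × (Fin n × Fin n → ℝ) × (Fin n × Fin n → ℝ) → Set Ω := fun b =>
    {ω | InjBound (fun i j k => X (i, j, k) ω) K ∧ t ≤
      ∑ p, ∑ q, decoupled (fun i j k => X (i, j, k) ω) b.1 p q * (b.2.1 p * b.2.2 q)}
  have hsub : {ω | ¬ SliceBound (fun i j k => X (i, j, k) ω) (48 * √c * (n : ℝ) ^ (3 / 4 : ℝ))} ⊆
      {ω | ¬ InjBound (fun i j k => X (i, j, k) ω) (s ^ 2)} ∪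
        ⋃ b ∈ (Finset.univ : Finset (Fin n → Bool)) ×ˢ N ×ˢ N, F b := by
    intro ω hω
    by_contra hcon
    rw [Set.mem_union, not_or] at hcon
    obtain ⟨h1, h2⟩ := hcon
    simp only [Set.mem_ofPred_eq, not_not] at h1
    refine hω (sliceBound_of_real_bounds h1 (t := t)
      (fun S x => quadForm_le_of_net hN ht0 (fun x hx y hy => ?_) x) ?_)
    · simp only [Set.mem_iUnion, not_exists] at h2
      have := h2 (S, x, y) (by simp [hx, hy])
      simp only [F, Set.mem_ofPred_eq, hK, h1, true_and, not_le] at this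
      exact this.le
    · rw [mul_pow, mul_pow, rpow_three_quarters_sq, Real.sq_sqrt hc'.le, hs2, ht]
      have h3 : (1 : ℝ) ≤ √n := Real.one_le_sqrt.mpr hn'
      have h4 : (c : ℝ) * n * 1 ≤ c * n * √n := by gcongr
      linarith
  have hinj : μ {ω | ¬ InjBound (fun i j k => X (i, j, k) ω) (s ^ 2)} ≤
      ENNReal.ofReal (Real.exp (-n)) := by
    refine (measure_not_injBound_le hX hc (Real.sqrt_nonneg _)).trans (ENNReal.ofReal_le_ofReal ?_)
    have h125 : (125 : ℝ) ≤ Real.exp 1 ^ 5 :=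
      le_trans (by norm_num) (pow_le_pow_left₀ (by norm_num) hexp.le 5)
    rw [Fintype.card_fin, ← hs, hs2]
    calc (125 : ℝ) ^ n * Real.exp (-(768 * c * n) / (128 * c))
        ≤ (Real.exp 1 ^ 5) ^ n * Real.exp (-(768 * c * n) / (128 * c)) := by gcongr
      _ = Real.exp (-n) := by
        rw [← Real.exp_nat_mul, ← Real.exp_nat_mul, ← Real.exp_add]
        congr 1
        field_simp
        push_cast
        ring
  have hdec : μ (⋃ b ∈ (Finset.univ : Finset (Fin n → Bool)) ×ˢ N ×ˢ N, F b) ≤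
      ENNReal.ofReal (Real.exp (-n)) := by
    refine (measure_biUnion_finset_le_card_mul _ _
      (q := ENNReal.ofReal (Real.exp (-t ^ 2 / (32 * (K * c))))) fun b hb => ?_).trans ?_
    · simp only [Finset.mem_product] at hb
      exact measure_decoupled_le hX hc b.1 (hN4 _ hb.2.1) (hN4 _ hb.2.2) K ht0
    · rw [← ENNReal.ofReal_natCast, ← ENNReal.ofReal_mul (by positivity)]
      refine ENNReal.ofReal_le_ofReal ?_
      have hexponent : -t ^ 2 / (32 * (K * c)) = -(6 * (n : ℝ) ^ 2) := by
        rw [hK, hs2, ht, mul_pow, mul_pow, mul_pow, Real.sq_sqrt (by positivity)]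
        field_simp
        norm_num
      have hcardR : (N.card : ℝ) ≤ 5 ^ (n * n) := by
        have := hcard
        rw [Fintype.card_prod, Fintype.card_fin] at this
        exact_mod_cast this
      have h25 : (25 : ℝ) ≤ Real.exp 1 ^ 4 :=
        le_trans (by norm_num) (pow_le_pow_left₀ (by norm_num) hexp.le 4)
      have h2 : (2 : ℝ) ≤ Real.exp 1 := by linarith
      rw [hexponent, Finset.card_product, Finset.card_product, Finset.card_univ, Fintype.card_fun,
        Fintype.card_bool, Fintype.card_fin]
      push_cast
      calc (2 : ℝ) ^ n * (N.card * N.card) * Real.exp (-(6 * (n : ℝ) ^ 2))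
          ≤ 2 ^ n * (5 ^ (n * n) * 5 ^ (n * n)) * Real.exp (-(6 * (n : ℝ) ^ 2)) := by gcongr
        _ = 2 ^ n * 25 ^ (n * n) * Real.exp (-(6 * (n : ℝ) ^ 2)) := by
          rw [← mul_pow]
          norm_num
        _ ≤ Real.exp 1 ^ n * (Real.exp 1 ^ 4) ^ (n * n) * Real.exp (-(6 * (n : ℝ) ^ 2)) := by
          gcongr
        _ = Real.exp (n - 2 * (n : ℝ) ^ 2) := by
          rw [← Real.exp_nat_mul, ← Real.exp_nat_mul, ← Real.exp_nat_mul, ← Real.exp_add,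
            ← Real.exp_add]
          congr 1
          push_cast
          ring
        _ ≤ Real.exp (-n) := by
          refine Real.exp_le_exp.mpr ?_
          nlinarith
  refine (measure_mono hsub).trans ((measure_union_le _ _).trans ((add_le_add hinj hdec).trans_eq
    ?_))
  rw [← ENNReal.ofReal_add (Real.exp_pos _).le (Real.exp_pos _).le]
  congr 1
  ring

theorem measure_not_cubicBound_le {T : Ω → Tensor n} (hn : 1 ≤ n) (hc0 : 0 < c)
    (hT : iIndepFun (fun α ω => T ω α) μ) (hc : ∀ α, HasSubgaussianMGF (fun ω => T ω α) c μ) :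
    μ {ω | ¬ CubicBound (T ω) (48 * √c * (n : ℝ) ^ (3 / 4 : ℝ))} ≤
      ENNReal.ofReal (12 * Real.exp (-n)) := by
  let g : Equiv.Perm (Fin 3) → Fin n × Fin n × Fin n → Fin 3 → Fin n := fun π p r =>
    ![p.1, p.2.1, p.2.2] (π⁻¹ r)
  have hg : ∀ π, Function.Injective (g π) := by
    intro π p p' h
    refine (tripleEquiv n).injective (funext fun r => ?_)
    have := congrFun h (π r)
    have h' : ![p.1, p.2.1, p.2.2] r = ![p'.1, p'.2.1, p'.2.2] r := by simpa [g] using this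
    exact h'
  have hsub : {ω | ¬ CubicBound (T ω) (48 * √c * (n : ℝ) ^ (3 / 4 : ℝ))} ⊆
      ⋃ π ∈ (Finset.univ : Finset (Equiv.Perm (Fin 3))),
        {ω | ¬ SliceBound (fun i j k => T ω (g π (i, j, k))) (48 * √c * (n : ℝ) ^ (3 / 4 : ℝ))} := by
    intro ω hω
    by_contra hcon
    simp only [Finset.mem_univ, Set.iUnion_true, Set.mem_iUnion, Set.mem_ofPred_eq,
      not_exists, not_not] at hcon
    exact hω (cubicBound_of_permTensor hcon)
  refine (measure_mono hsub).trans ((measure_biUnion_finset_le_card_mul _ _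
    (q := ENNReal.ofReal (2 * Real.exp (-n))) fun π _ => ?_).trans_eq ?_)
  · exact measure_not_sliceBound_le (X := fun p ω => T ω (g π p)) hn hc0 (hT.precomp (hg π))
      fun p => hc (g π p)
  · rw [Finset.card_univ, Fintype.card_perm, Fintype.card_fin, ← ENNReal.ofReal_natCast,
      ← ENNReal.ofReal_mul (by positivity)]
    congr 1
    norm_num [Nat.factorial]
    ring

end

/-! ### Gaussian noise -/

section

variable {Ω : Type*} [MeasurableSpace Ω] {P : Measure Ω}

theorem hasSubgaussianMGF_of_hasLaw_gaussian {X : Ω → ℝ} (h : HasLaw X (gaussianReal 0 1) P) :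
    HasSubgaussianMGF X 1 P where
  integrable_exp_mul t := by
    have := integrable_exp_mul_gaussianReal (μ := 0) (v := 1) t
    rw [← h.map_eq] at this
    exact (integrable_map_measure (by fun_prop) h.aemeasurable).mp this
  mgf_le t := by
    rw [mgf_gaussianReal h.map_eq]
    simp

/-- Adding variables that are identically zero preserves independence. -/
theorem iIndepFun_of_subtype {κ : Type*} {p : κ → Prop} {f : κ → Ω → ℝ} [IsProbabilityMeasure P]
    (h : iIndepFun (fun α : {α // p α} => f α) P) (h0 : ∀ α, ¬ p α → f α = fun _ => 0) :
    iIndepFun f P := by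
  classical
  rw [iIndepFun_iff_measure_inter_preimage_eq_mul] at h ⊢
  intro S B hB
  by_cases hz : ∀ α ∈ S, ¬ p α → (0 : ℝ) ∈ B α
  · have huniv : ∀ α ∈ S, ¬ p α → f α ⁻¹' B α = Set.univ := by
      intro α hα hp
      ext ω
      simp [h0 α hp, hz α hα hp]
    have h1 := h (S.subtype p) (sets := fun α => B α) fun α hα => hB _ (Finset.mem_subtype.mp hα)
    have e1 : (⋂ α ∈ S, f α ⁻¹' B α) = ⋂ α ∈ S.subtype p, f α ⁻¹' B α := by
      ext ω
      simp only [Set.mem_iInter, Finset.mem_subtype, Subtype.forall]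
      refine ⟨fun hω α _ hα => hω α hα, fun hω α hα => ?_⟩
      by_cases hp : p α
      · exact hω α hp hα
      · rw [huniv α hα hp]; trivial
    have e2 : ∏ α ∈ S, P (f α ⁻¹' B α) = ∏ α ∈ S.subtype p, P (f α ⁻¹' B α) := by
      have hone : ∏ α ∈ S.filter fun α => ¬ p α, P (f α ⁻¹' B α) = 1 :=
        Finset.prod_eq_one fun α hα => by
          rw [Finset.mem_filter] at hα
          rw [huniv α hα.1 hα.2, measure_univ]
      rw [← Finset.prod_filter_mul_prod_filter_not S p, hone, mul_one,
        Finset.prod_subtype_eq_prod_filter (f := fun α => P (f α ⁻¹' B α))]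
    rw [e1, e2, h1]
  · push Not at hz
    obtain ⟨α, hα, hp, hαB⟩ := hz
    have hempty : f α ⁻¹' B α = ∅ := by
      ext ω
      simp [h0 α hp, hαB]
    rw [Finset.prod_eq_zero hα (by rw [hempty, measure_empty]), ← nonpos_iff_eq_zero]
    refine (measure_mono (Set.biInter_subset_of_mem hα)).trans_eq ?_
    rw [hempty, measure_empty]

theorem IsGaussianNoise.measure_not_cubicBound_le {n : ℕ} {A : Ω → Tensor n}
    (hA : IsGaussianNoise A P) (hn : 1 ≤ n) :
    P {ω | ¬ CubicBound (A ω) (288 * (n : ℝ) ^ (3 / 4 : ℝ))} ≤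
      ENNReal.ofReal (12 * Real.exp (-n)) := by
  have h := TensorPCA.measure_not_cubicBound_le (c := 36) hn (by norm_num) hA.indep fun α =>
    HasSubgaussianMGF.mono (hasSubgaussianMGF_of_hasLaw_gaussian (hA.hasLaw α)) (by norm_num)
  have e : 48 * √((36 : ℝ≥0) : ℝ) = 288 := by
    rw [show ((36 : ℝ≥0) : ℝ) = 6 ^ 2 by norm_num, Real.sqrt_sq (by norm_num)]
    norm_num
  rwa [e] at h

theorem IsSymmetricGaussianNoise.measure_not_cubicBound_le {n : ℕ} {A : Ω → Tensor n}
    [IsProbabilityMeasure P] (hA : IsSymmetricGaussianNoise A P) (hn : 1 ≤ n) :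
    P {ω | ¬ CubicBound (A ω) (288 * (n : ℝ) ^ (3 / 4 : ℝ))} ≤
      ENNReal.ofReal (12 * Real.exp (-n)) := by
  let T : Ω → Tensor n := fun ω α => (sortedMultiplicity α : ℝ) * A ω α
  have hind : iIndepFun (fun α ω => T ω α) P := by
    refine iIndepFun_of_subtype (p := Monotone) ?_ fun α hα => ?_
    · exact hA.indep.comp (fun α x => (sortedMultiplicity α.1 : ℝ) * x) fun α =>
        measurable_const_mul _
    · ext ω
      simp [T, sortedMultiplicity_eq_zero hα]
  have hsub : ∀ α, HasSubgaussianMGF (fun ω => T ω α) 36 P := by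
    intro α
    have h6 : (sortedMultiplicity α : ℝ) ≤ 6 := by exact_mod_cast sortedMultiplicity_le α
    have hle : NNReal.mk ((sortedMultiplicity α : ℝ) ^ 2) (sq_nonneg _) * 1 ≤ 36 := by
      rw [mul_one, ← NNReal.coe_le_coe]
      calc (sortedMultiplicity α : ℝ) ^ 2 ≤ 6 ^ 2 := pow_le_pow_left₀ (Nat.cast_nonneg _) h6 2
        _ = _ := by norm_num
    exact HasSubgaussianMGF.mono
      ((hasSubgaussianMGF_of_hasLaw_gaussian (hA.hasLaw α)).const_mul (sortedMultiplicity α)) hle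
  have h := TensorPCA.measure_not_cubicBound_le (c := 36) hn (by norm_num) hind hsub
  have e : 48 * √((36 : ℝ≥0) : ℝ) = 288 := by
    rw [show ((36 : ℝ≥0) : ℝ) = 6 ^ 2 by norm_num, Real.sqrt_sq (by norm_num)]
    norm_num
  rw [e] at h
  refine (measure_mono (Set.ofPred_subset_ofPred.mpr fun ω hω hcon => hω ?_)).trans h
  exact hcon.of_tensorPoly_eq (tensorPoly_eq_of_symm (hA.symm ω))

end

theorem rpow_three_quarters_le_rate {n : ℕ} (hn : 3 ≤ n) : (n : ℝ) ^ (3 / 4 : ℝ) ≤ rate n := by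
  have hn' : (3 : ℝ) ≤ n := by exact_mod_cast hn
  have hlog : 1 ≤ Real.log n := by
    rw [Real.le_log_iff_exp_le (by linarith)]
    exact (Real.exp_one_lt_d9.le.trans (by norm_num)).trans hn'
  exact le_mul_of_one_le_right (by positivity) (Real.one_le_rpow hlog (by norm_num))

theorem exp_neg_le_div_pow {n : ℕ} (hn : 1 ≤ n) :
    12 * Real.exp (-n) ≤ 43545600 / (n : ℝ) ^ 10 := by
  have hn' : (0 : ℝ) < n := by exact_mod_cast hn
  have h := Real.pow_div_factorial_le_exp (n : ℝ) hn'.le 10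
  rw [Real.exp_neg, ← div_eq_mul_inv, div_le_div_iff₀ (Real.exp_pos _) (by positivity)]
  norm_num [Nat.factorial] at h
  linarith

/-- Recovery and certification for a fixed noise tensor with bounded slices. -/
theorem CubicBound.recovers_and_alwaysCertifies {n : ℕ} {A : Tensor n} (hn : 3 ≤ n)
    (hA : CubicBound A (288 * (n : ℝ) ^ (3 / 4 : ℝ))) {v₀ : EuclideanSpace ℝ (Fin n)}
    (hv₀ : ‖v₀‖ = 1) {c ε τ : ℝ} (hc : 0 < c) (hε : 0 < ε) (hτ : c * rate n / ε ≤ τ) :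
    Recovers (57600 / c * ε) v₀ (spiked τ v₀ A) ∧ AlwaysCertifies 20160 τ (spiked τ v₀ A) := by
  have hrate := rpow_three_quarters_le_rate hn
  have hpow : 0 < (n : ℝ) ^ (3 / 4 : ℝ) := Real.rpow_pos_of_pos (by exact_mod_cast (by omega)) _
  have hrpos : 0 < rate n := hpow.trans_le hrate
  have hτ0 : 0 < τ := lt_of_lt_of_le (by positivity) hτ
  refine ⟨fun v hv => ?_, fun v hv => ?_⟩
  · have h := hA.one_sub_inner_le (by positivity) hτ0 hv₀ hv
    have hv1 : ‖v‖ ≤ 1 := by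
      obtain ⟨L, -, rfl⟩ := hv
      exact norm_inv_smul_le_one _
    have hratio : 288 * (n : ℝ) ^ (3 / 4 : ℝ) / τ ≤ 288 / c * ε := by
      rw [div_le_iff₀ hτ0]
      rw [div_le_iff₀ hε] at hτ
      calc 288 * (n : ℝ) ^ (3 / 4 : ℝ) ≤ 288 / c * (c * rate n) := by
            field_simp
            exact hrate
        _ ≤ 288 / c * (τ * ε) := by gcongr
        _ = _ := by ring
    set κ := 288 / c * ε with hκ
    have hκ0 : 0 < κ := by positivity
    have hC : 57600 / c * ε = 200 * κ := by rw [hκ]; ring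
    rw [hC]
    rcases le_total κ 1 with h1 | h1
    · have h2 : (288 * (n : ℝ) ^ (3 / 4 : ℝ) / τ) ^ 2 ≤ κ ^ 2 :=
        pow_le_pow_left₀ (by positivity) hratio 2
      -- `200 (R / τ)² ≤ 200 κ² ≤ 200 κ`
      nlinarith
    · -- the claim is void, as `⟨v, v₀⟩ ≥ -1`
      have h3 := neg_le_of_abs_le (abs_real_inner_le_norm v v₀)
      rw [hv₀, mul_one] at h3
      linarith
  · exact hA.certifies (by positivity) hτ0 (by omega) hv₀ hv (by linarith)

end TensorPCA

theorem mainTheorem1 :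
    -- both semidefinite programs attain their maximum, so that the algorithms have an output
    (∀ (n : ℕ), 0 < n → ∀ p : TensorPCA.PolyLE n 4,
      ∃ L : TensorPCA.PolyLE n 4 →ₗ[ℝ] ℝ, TensorPCA.IsOptimal L p) ∧
    -- certification never errs
    (∀ (Θ : ℝ) (n : ℕ) (τ : ℝ) (v₀ : EuclideanSpace ℝ (Fin n)), ‖v₀‖ = 1 →
      ∀ (A : TensorPCA.Tensor n) (v : EuclideanSpace ℝ (Fin n)),
        TensorPCA.IsRecoveryOutput (TensorPCA.spiked τ v₀ A) v →
        TensorPCA.Certifies Θ τ (TensorPCA.spiked τ v₀ A) v →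
        ∀ x : EuclideanSpace ℝ (Fin n), ‖x‖ = 1 →
          TensorPCA.tensorEval (TensorPCA.spiked τ v₀ A) x ≤
            τ * (inner ℝ v x) ^ 3 +
              Θ * TensorPCA.rate n) ∧
    -- recovery and certification succeed with high probability
    (∃ Θ > (0 : ℝ), ∃ K > (0 : ℝ), ∀ c > (0 : ℝ), ∃ C > (0 : ℝ),
      ∀ (n : ℕ) (v₀ : EuclideanSpace ℝ (Fin n)), ‖v₀‖ = 1 →
      ∀ (ε τ : ℝ), 0 < ε →
        c * TensorPCA.rate n / ε ≤ τ →
      ∀ (Ω : Type*) [MeasurableSpace Ω] (P : MeasureTheory.Measure Ω)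
        [MeasureTheory.IsProbabilityMeasure P] (A : Ω → TensorPCA.Tensor n),
        -- independent Gaussian noise, and its symmetrization
        (TensorPCA.IsGaussianNoise A P →
          P {ω | ¬ (TensorPCA.Recovers (C * ε) v₀ (TensorPCA.spiked τ v₀ (A ω)) ∧
              TensorPCA.AlwaysCertifies Θ τ (TensorPCA.spiked τ v₀ (A ω)) ∧
              TensorPCA.Recovers (C * ε) v₀
                (TensorPCA.spiked τ v₀ (TensorPCA.symmetrize (A ω))) ∧
              TensorPCA.AlwaysCertifies Θ τ
                (TensorPCA.spiked τ v₀ (TensorPCA.symmetrize (A ω))))}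
            ≤ ENNReal.ofReal (K / (n : ℝ) ^ 10)) ∧
        -- symmetric noise with otherwise iid standard Gaussian entries
        (TensorPCA.IsSymmetricGaussianNoise A P →
          P {ω | ¬ (TensorPCA.Recovers (C * ε) v₀ (TensorPCA.spiked τ v₀ (A ω)) ∧
              TensorPCA.AlwaysCertifies Θ τ (TensorPCA.spiked τ v₀ (A ω)))}
            ≤ ENNReal.ofReal (K / (n : ℝ) ^ 10))) := by
  refine ⟨fun n hn p => TensorPCA.exists_isOptimal hn p, ?_, 20160, by norm_num, 43545600,
    by norm_num, fun c hc => ⟨57600 / c, by positivity, ?_⟩⟩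
  · intro Θ n τ v₀ _ A v _ hcert x hx
    exact hcert.tensorEval_le hx
  intro n v₀ hv₀ ε τ hε hτ Ω _ P _ A
  have hn1 : 1 ≤ n := by
    rcases Nat.eq_zero_or_pos n with rfl | hn
    · rw [Subsingleton.elim v₀ 0, norm_zero] at hv₀
      exact absurd hv₀ zero_ne_one
    · exact hn
  rcases Nat.lt_or_ge n 3 with hn3 | hn3
  · -- for `n ≤ 2` the claimed bound on the probability exceeds `1`
    have hbound : ∀ s : Set Ω, P s ≤ ENNReal.ofReal (43545600 / (n : ℝ) ^ 10) := by
      intro s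
      refine MeasureTheory.prob_le_one.trans (ENNReal.one_le_ofReal.mpr ?_)
      have hpos : (0 : ℝ) < n := by exact_mod_cast hn1
      have hn2 : (n : ℝ) ≤ 2 := by exact_mod_cast Nat.lt_succ_iff.mp hn3
      rw [le_div_iff₀ (by positivity), one_mul]
      exact (pow_le_pow_left₀ hpos.le hn2 10).trans (by norm_num)
    exact ⟨fun _ => hbound _, fun _ => hbound _⟩
  have htail := ENNReal.ofReal_le_ofReal (TensorPCA.exp_neg_le_div_pow hn1)
  refine ⟨fun hA => ?_, fun hA => ?_⟩
  · refine (MeasureTheory.measure_mono (Set.ofPred_subset_ofPred.mpr fun ω hω hcon => hω ?_)).trans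
      ((hA.measure_not_cubicBound_le hn1).trans htail)
    have h1 := hcon.recovers_and_alwaysCertifies hn3 hv₀ hc hε hτ
    have h2 := (hcon.of_tensorPoly_eq
      (TensorPCA.tensorPoly_symmetrize (A ω))).recovers_and_alwaysCertifies hn3 hv₀ hc hε hτ
    exact ⟨h1.1, h1.2, h2.1, h2.2⟩
  · refine (MeasureTheory.measure_mono (Set.ofPred_subset_ofPred.mpr fun ω hω hcon => hω ?_)).trans
      ((hA.measure_not_cubicBound_le hn1).trans htail)
    exact hcon.recovers_and_alwaysCertifies hn3 hv₀ hc hε hτ
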